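/- Let $r\ge 2$ and let $F$ be a finite graph with $f=|V(F)|$ vertices. $F$ is called $r$-critical if $\chi(F)=r+1$ and $\chi(F-e)=r$ for some edge $e$ of $F$; such edges $e$ are called critical. An $r$-critical graph $F$ is called pair-free if there do not exist two different (not necessarily disjoint) edges $u_1v_1,u_2v_2$ of $F$ and a proper $r$-coloring $\chi$ of $F-u_1v_1-u_2v_2$ with $\chi(u_1)=\chi(v_1)=\chi(u_2)=\chi(v_2)$. Write $\#F(G)$ for the number of copies of $F$ in $G$ (subgraphs of $G$ isomorphic to $F$), and $\mathrm{ex}(n,F)$ for the maximum number of edges of an $F$-free graph on $n$ vertices. For $q\ge 0$ with $\mathrm{ex}(n,F)+q\le\binom n2$ let $h_F(n,q)$ be the minimum of $\#F(G)$ over all graphs $G$ with $n$ vertices and $\mathrm{ex}(n,F)+q$ edges, and let $t_F(n,q)$ be the minimum of $\#F(G)$ over all graphs $G$ obtained by adding $q$ edges to an $F$-free graph with $n$ vertices and $\mathrm{ex}(n,F)$ edges. Let $q_F(n)$ be the largest $q$ (with $\mathrm{ex}(n,F)+q\le \binom n2$) such that $h_F(n,q')=t_F(n,q')$ for all $q'\le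 q$, and for a residue class $i$ modulo $r$ let $$c_{1,i}(F)=\liminf_{n\to\infty,\ n\equiv i \ (\mathrm{mod}\ r)}\frac{q_F(n)}{n}.$$ Let $c(n_1,\dots,n_r;F)$ be the number of copies of $F$ in the graph obtained from the complete $r$-partite graph with parts of sizes $n_1,\dots,n_r$ by adding one edge inside the first part, that is, the polynomial $$c(n_1,\dots,n_r;F)=\frac1{\mathrm{Aut}(F)}\sum_{uv\ \text{critical}}\ \sum_{\chi}2\,(n_1-2)_{x_1}\prod_{i=2}^r (n_i)_{x_i},$$ where $\mathrm{Aut}(F)$ is the number of automorphisms of $F$, $\chi$ runs over the proper $r$-colorings of $F-uv$ with $\chi(u)=\chi(v)=1$, $x_i$ is the number of vertices other than $u,v$ of color $i$, and $(y)_k=y(y-1)\cdots(y-k+1)$. Let $\alpha_F$ be the coefficient of $n^{f-2}$ in the polynomial $c(n/r,\dots,n/r;F)$ in $n$, and let $\zeta_F$ be the coefficient of $n^{f-3}$ in $\frac{\partial c}{\partial n_2}(n/r,\dots,n/r)-\frac{\partial c}{\partial n_1}(n/r,\dots,n/r)$. Let $\pi_F=\alpha_F/|\zeta_F|$ if $\zeta_F\ne0$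 and $\pi_F=\infty$ if $\zeta_F=0$. Theorem. Let $F$ be a pair-free $r$-critical graph and let $t=\mathrm{sgn}(\zeta_F)\in\{-1,0,1\}$, read modulo $r$. Then $$c_{1,t}(F)\le 2\pi_F,\qquad\text{and}\qquad c_{1,i}(F)\le \pi_F\ \text{ for every residue class } i\not\equiv t \pmod r .$$ -/

import Mathlib

open Filter
open scoped ENNReal

noncomputable section

namespace ColorCritical

/-- An edge `e` of `F` is critical (with respect to `r`) if `χ(F - e) = r`. -/
def IsCriticalEdge {V : Type*} (F : SimpleGraph V) (r : ℕ) (e : Sym2 V) : Prop :=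
  e ∈ F.edgeSet ∧ (F.deleteEdges {e}).chromaticNumber = r

/-- `F` is `r`-critical: `χ(F) = r + 1` and `χ(F - e) = r` for some edge `e` of `F`. -/
def IsCritical {V : Type*} (F : SimpleGraph V) (r : ℕ) : Prop :=
  F.chromaticNumber = (r + 1 : ℕ) ∧ ∃ e, IsCriticalEdge F r e

/-- `F` is pair-free: it is `r`-critical, and there are no two distinct edges `e₁, e₂` of `F` and
proper `r`-coloring of `F - e₁ - e₂` giving all endpoints of `e₁` and `e₂` the same color. -/
def IsPairFree {V : Type*} (F : SimpleGraph V) (r : ℕ) : Prop :=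
  IsCritical F r ∧
    ¬ ∃ e₁ ∈ F.edgeSet, ∃ e₂ ∈ F.edgeSet, e₁ ≠ e₂ ∧
      ∃ χ : (F.deleteEdges {e₁, e₂}).Coloring (Fin r), ∃ c : Fin r,
        ∀ w : V, (w ∈ e₁ ∨ w ∈ e₂) → χ w = c

/-- `h_F(n, q)`: the minimum number of copies of `F` in a graph with `n` vertices and
`ex(n, F) + q` edges (used only when `ex(n, F) + q ≤ n.choose 2`, so that such graphs exist). -/
def hFun {V : Type*} (F : SimpleGraph V) (n q : ℕ) : ℕ :=
  sInf {m : ℕ | ∃ G : SimpleGraph (Fin n),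
    G.edgeSet.ncard = SimpleGraph.extremalNumber n F + q ∧ G.copyCount F = m}

/-- `t_F(n, q)`: the minimum number of copies of `F` in a graph obtained by adding `q` edges to
a maximum `F`-free graph on `n` vertices (again used only when `ex(n, F) + q ≤ n.choose 2`). -/
def tFun {V : Type*} (F : SimpleGraph V) (n q : ℕ) : ℕ :=
  sInf {m : ℕ | ∃ G₀ G : SimpleGraph (Fin n),
    F.Free G₀ ∧ G₀.edgeSet.ncard = SimpleGraph.extremalNumber n F ∧
    G₀ ≤ G ∧ G.edgeSet.ncard = SimpleGraph.extremalNumber n F + q ∧ G.copyCount F = m}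

/-- `q_F(n)`: the largest `q` (among those for which graphs with `n` vertices and
`ex(n, F) + q` edges exist) such that `h_F(n, q') = t_F(n, q')` for all `q' ≤ q`. -/
def qFun {V : Type*} (F : SimpleGraph V) (n : ℕ) : ℕ :=
  sSup {q : ℕ | SimpleGraph.extremalNumber n F + q ≤ n.choose 2 ∧
    ∀ q' ≤ q, hFun F n q' = tFun F n q'}

/-- `c_{1,i}(F)`: the limit inferior of `q_F(n) / n` as `n → ∞` along `n ≡ i (mod r)`. -/
def c1 {V : Type*} (F : SimpleGraph V) (r : ℕ) (i : ZMod r) : ℝ≥0∞ :=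
  liminf (fun n : ℕ => (qFun F n : ℝ≥0∞) / (n : ℝ≥0∞)) (atTop ⊓ 𝓟 {n : ℕ | (n : ZMod r) = i})

section Parameters

variable {V : Type*} [Fintype V] (F : SimpleGraph V) (r : ℕ) [r.AtLeastTwo]

open scoped Classical in
/-- The polynomial `c(n₁, …, n_r; F)` in the part sizes `n_i` (the parts are indexed by `Fin r`, and
the variable `X 0` stands for `n₁`),
`(1 / Aut(F)) * ∑_{uv critical} ∑_χ 2 * (n₁ - 2)_{x₁} * ∏_{i ≥ 2} (n_i)_{x_i}`.
Here `χ` runs over the proper `r`-colorings of `F - uv` in which `u` and `v` get the first color,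
`x_i` is the number of vertices other than `u, v` with color `i`, and `(y)_k` is the falling
factorial. For part sizes `n_i` it counts the copies of `F` in the complete
`r`-partite graph with these part sizes and one additional edge inside the first part. -/
def cPoly : MvPolynomial (Fin r) ℝ :=
  MvPolynomial.C (1 / (Nat.card (F ≃g F) : ℝ)) *
    ∑ e : Sym2 V with IsCriticalEdge F r e,
      ∑ χ : (F.deleteEdges {e}).Coloring (Fin r) with ∀ w ∈ e, χ w = 0,
        2 * ∏ i : Fin r,
          Polynomial.aeval
            (if i = 0 then MvPolynomial.X i - 2 else MvPolynomial.X i : MvPolynomial (Fin r) ℝ)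
            (descPochhammer ℝ (Finset.card {w : V | w ∉ e ∧ χ w = i}))

/-- Substitution of `n / r` for all the variables; the result is a polynomial in `n`. -/
def balanced (p : MvPolynomial (Fin r) ℝ) : Polynomial ℝ :=
  MvPolynomial.aeval (fun _ : Fin r => Polynomial.C (1 / (r : ℝ)) * Polynomial.X) p

/-- `α_F`: the coefficient of `n ^ (f - 2)` in `c(n/r, …, n/r; F)`, where `f = |V(F)|`. -/
def alpha : ℝ :=
  (balanced r (cPoly F r)).coeff (Fintype.card V - 2)

/-- `ζ_F`: the coefficient of `n ^ (f - 3)` in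
`∂c/∂n₂ (n/r, …, n/r) - ∂c/∂n₁ (n/r, …, n/r)`, where `f = |V(F)|`. -/
def zeta : ℝ :=
  (balanced r (MvPolynomial.pderiv 1 (cPoly F r)) -
    balanced r (MvPolynomial.pderiv 0 (cPoly F r))).coeff (Fintype.card V - 3)

open scoped Classical in
/-- `π_F = α_F / |ζ_F|` if `ζ_F ≠ 0`, and `π_F = ∞` if `ζ_F = 0`. -/
def piParam : ℝ≥0∞ :=
  if zeta F r = 0 then ⊤ else ENNReal.ofReal (alpha F r / |zeta F r|)

end Parameters

end ColorCritical

end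

namespace ColorCritical

open Finset SimpleGraph
open scoped Classical

/-! If `ζ_F = 0` both bounds are infinite, so let `ζ_F ≠ 0`. By Simonovits' theorem
(`eventually_iso_turanGraph`) the Turán graph is, for large n, the unique extremal graph, so `t_F(n,
q)` concerns q edges added inside the parts of the Turán graph. The copies with exactly one edge
inside a part form disjoint classes for different added edges, and each class has size given by the
polynomial c. Hence `t_F(n, q) ≥ q * min c`, the minimum being over the choice of the part listed
first (`mul_le_copyCount`, `eventually_mul_le_tFun`).

A competitor beats this for `q ≥ βn` when `β > L α_F / |ζ_F|`. Move one vertex from part b to part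
a. This loses `L = |V_a| - |V_b| + 1` edges, so q + L edges must be put inside one part s. Because c
is symmetric in all variables but the first, changing the first part size by δ at constant total
changes c by `-δ ζ_F n^(f-3) + O(n^(f-4))` (`powBound_cPoly_sub`). So s is a largest part that grows
if `ζ_F > 0`, and a smallest part that shrinks if `ζ_F < 0`. Each inner edge then lies in about
`|ζ_F| n^(f-3)` fewer copies. The total saving `q |ζ_F| n^(f-3)` outweighs the cost `L α_F n^(f-2)`
of the L extra edges.

It remains to bound the copies with several inner edges. The inner edges are chosen within disjoint
balanced complete bipartite graphs of bounded size, all in one part (`exists_isBlockGraph`).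
Pair-freeness forbids copies with exactly two inner edges. With three or more, triangle-freeness
yields a three-edge forest, so three vertices are determined up to boundedly many choices and there
are only `O(n^(f-3))` such copies (`card_multiple_mono_le`), a lower order term.

Finally L is 1, except when s is the only part of its size, which happens exactly for `n ≡ sgn(ζ_F)`
mod r and gives L = 2. -/

/-! ### Embedding a color-critical graph, and greedy choice of complete parts. -/

/-- A graph `F` that is not `r`-colorable but becomes so after deleting one edge embeds into any
graph containing a large complete `r`-partite graph together with an edge inside one part. -/
lemma isContained_of_parts {V W : Type*} [Fintype V] {F : SimpleGraph V} {G : SimpleGraph W}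
    {r : ℕ} (hF : ¬ F.Colorable r) {e : Sym2 V} (he : (F.deleteEdges {e}).Colorable r)
    (S : Fin r → Finset W) (hS : ∀ i, Fintype.card V + 2 ≤ #(S i))
    (hadj : ∀ i j, i ≠ j → ∀ a ∈ S i, ∀ b ∈ S j, G.Adj a b) {i : Fin r} {x y : W}
    (hxy : G.Adj x y) (hx : ∀ j, j ≠ i → ∀ b ∈ S j, G.Adj x b)
    (hy : ∀ j, j ≠ i → ∀ b ∈ S j, G.Adj y b) : F ⊑ G := by
  obtain ⟨χ⟩ := he
  induction e with
  | _ u v =>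
  -- If `uv` were not an edge with equally colored ends, `χ` would already color all of `F`.
  have huv : F.Adj u v ∧ χ u = χ v := by
    by_contra h
    refine hF ⟨Coloring.mk χ ?_⟩
    intro a b hab hχ
    by_cases hs : s(a, b) = s(u, v)
    · rcases Sym2.eq_iff.1 hs with ⟨rfl, rfl⟩ | ⟨rfl, rfl⟩
      · exact h ⟨hab, hχ⟩
      · exact h ⟨hab.symm, hχ.symm⟩
    · exact χ.valid (deleteEdges_adj.2 ⟨hab, by simpa using hs⟩) hχ
  have huv' : u ≠ v := huv.1.ne
  -- The colors are renamed so that the color of `u` and `v` corresponds to part `i`, beside which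
  -- `x` and `y` act.
  set σ : Equiv.Perm (Fin r) := Equiv.swap (χ u) i with hσ
  -- The surplus 2 in the part sizes pays for avoiding `x` and `y`, which may or may not lie in the
  -- parts.
  have hemb : ∀ j, Nonempty (V ↪ ↥((S j).erase x |>.erase y)) := by
    intro j
    rw [Function.Embedding.nonempty_iff_card_le, Fintype.card_coe]
    have h1 := Finset.pred_card_le_card_erase (s := S j) (a := x)
    have h2 := Finset.pred_card_le_card_erase (s := (S j).erase x) (a := y)
    have := hS j
    omega
  have hemb' : ∀ j, ∃ g : V → W, Function.Injective g ∧ ∀ w, g w ∈ S j ∧ g w ≠ x ∧ g w ≠ y := by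
    intro j
    obtain ⟨g⟩ := hemb j
    refine ⟨fun w => g w, fun a b hab => g.injective (Subtype.ext hab), fun w => ?_⟩
    have := (g w).2
    simp only [mem_erase] at this
    tauto
  choose g hginj hg using hemb'
  let φ : V → W := fun w => if w = u then x else if w = v then y else g (σ (χ w)) w
  have φu : φ u = x := by simp [φ]
  have φv : φ v = y := by simp [φ, huv'.symm]
  have φw : ∀ w, w ≠ u → w ≠ v → φ w = g (σ (χ w)) w := by
    intro w h1 h2; simp [φ, h1, h2]
  have hSne : ∀ j k a b, a ∈ S j → b ∈ S k → j ≠ k → a ≠ b := by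
    intro j k a b ha hb hjk hab
    subst hab
    exact G.irrefl (hadj j k hjk a ha a hb)
  have hinj : Function.Injective φ := by
    intro a b hab
    by_cases hau : a = u
    · subst hau
      by_cases hbv : b = v
      · subst hbv; rw [φu, φv] at hab; exact absurd hab hxy.ne
      · by_contra hne
        rw [φu, φw b (Ne.symm hne) hbv] at hab
        exact (hg _ b).2.1 hab.symm
    by_cases hav : a = v
    · subst hav
      by_cases hbv : b = u
      · subst hbv; rw [φu, φv] at hab; exact absurd hab hxy.ne'
      · by_contra hne
        rw [φv, φw b hbv (Ne.symm hne)] at hab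
        exact (hg _ b).2.2 hab.symm
    rw [φw a hau hav] at hab
    by_cases hbu : b = u
    · subst hbu; rw [φu] at hab; exact absurd hab (hg _ a).2.1
    by_cases hbv : b = v
    · subst hbv; rw [φv] at hab; exact absurd hab (hg _ a).2.2
    rw [φw b hbu hbv] at hab
    by_cases hc : σ (χ a) = σ (χ b)
    · rw [hc] at hab; exact hginj _ hab
    · exact absurd hab (hSne _ _ _ _ (hg _ a).1 (hg _ b).1 hc)
  have hσu : σ (χ u) = i := by simp [hσ]
  have hval : ∀ a b, F.Adj a b → s(a, b) ≠ s(u, v) → σ (χ a) ≠ σ (χ b) := by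
    intro a b hab hs h
    exact χ.valid (deleteEdges_adj.2 ⟨hab, by simpa using hs⟩) (σ.injective h)
  have key : ∀ a b, F.Adj a b → a ≠ u → a ≠ v → G.Adj (φ b) (φ a) := by
    intro a b hab hau hav
    rw [φw a hau hav]
    have hs : s(a, b) ≠ s(u, v) := by
      intro h
      rcases Sym2.eq_iff.1 h with ⟨h, -⟩ | ⟨h, -⟩
      · exact hau h
      · exact hav h
    have hc := hval a b hab hs
    by_cases hbu : b = u
    · subst hbu; rw [φu]; rw [hσu] at hc; exact hx _ hc _ (hg _ a).1
    by_cases hbv : b = v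
    · subst hbv; rw [φv]; rw [← huv.2, hσu] at hc; exact hy _ hc _ (hg _ a).1
    rw [φw b hbu hbv]
    exact hadj _ _ hc.symm _ (hg _ b).1 _ (hg _ a).1
  refine ⟨⟨⟨φ, ?_⟩, hinj⟩⟩
  intro a b hab
  by_cases ha : a ≠ u ∧ a ≠ v
  · exact (key a b hab ha.1 ha.2).symm
  by_cases hb : b ≠ u ∧ b ≠ v
  · exact key b a hab.symm hb.1 hb.2
  have hab' := hab.ne
  have : (a = u ∧ b = v) ∨ (a = v ∧ b = u) := by
    by_cases h1 : a = u <;> by_cases h2 : b = u <;> simp_all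
  rcases this with ⟨rfl, rfl⟩ | ⟨rfl, rfl⟩
  · rw [φu, φv]; exact hxy
  · rw [φu, φv]; exact hxy.symm

/-- Greedy choice of a complete `r`-partite subgraph inside nearly complete parts. -/
lemma exists_complete_parts {W : Type*} {G : SimpleGraph W} {r s D : ℕ} (U : Fin r → Finset W)
    (hD : ∀ j k, j ≠ k → ∀ a ∈ U j, #{b ∈ U k | ¬ G.Adj a b} ≤ D)
    (hU : ∀ k, s + r * s * D ≤ #(U k)) :
    ∃ S : Fin r → Finset W, (∀ i, S i ⊆ U i) ∧ (∀ i, #(S i) = s) ∧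
      ∀ i j, i ≠ j → ∀ a ∈ S i, ∀ b ∈ S j, G.Adj a b := by
  suffices H : ∀ J : Finset (Fin r), ∃ S : Fin r → Finset W, (∀ i, S i ⊆ U i) ∧
      (∀ i ∈ J, #(S i) = s) ∧ ∀ i ∈ J, ∀ j ∈ J, i ≠ j → ∀ a ∈ S i, ∀ b ∈ S j, G.Adj a b by
    obtain ⟨S, h1, h2, h3⟩ := H univ
    exact ⟨S, h1, fun i => h2 i (mem_univ _), fun i j => h3 i (mem_univ _) j (mem_univ _)⟩
  intro J
  induction J using Finset.induction_on with
  | empty => exact ⟨fun _ => ∅, by simp⟩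
  | insert k J hk ih =>
    obtain ⟨S, h1, h2, h3⟩ := ih
    -- The vertices of `U k` spoiled by earlier choices: at most `r * s` chosen vertices, each
    -- spoiling at most `D`.
    let X := J.biUnion fun j => (S j).biUnion fun a => {b ∈ U k | ¬ G.Adj a b}
    have hX : #X ≤ r * s * D := by
      calc #X ≤ #J * (s * D) := by
            refine card_biUnion_le_card_mul _ _ _ fun j hj => ?_
            rw [← h2 j hj]
            refine card_biUnion_le_card_mul _ _ _ fun a ha => ?_
            exact hD j k (fun h => hk (h ▸ hj)) a (h1 j ha)
        _ ≤ r * (s * D) := by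
            gcongr
            simpa using card_le_univ J
        _ = r * s * D := by ring
    have hT : s ≤ #(U k \ X) := by
      have := le_card_sdiff X (U k)
      have := hU k
      omega
    obtain ⟨T, hT1, hT2⟩ := exists_subset_card_eq hT
    have hTX : ∀ j ∈ J, ∀ a ∈ S j, ∀ b ∈ T, G.Adj a b := by
      intro j hj a ha b hb
      have hb' := hT1 hb
      rw [Finset.mem_sdiff] at hb'
      by_contra hab
      exact hb'.2 (mem_biUnion.2 ⟨j, hj, mem_biUnion.2 ⟨a, ha, mem_filter.2 ⟨hb'.1, hab⟩⟩⟩)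
    refine ⟨Function.update S k T, fun i => ?_, fun i hi => ?_, fun i hi j hj hij a ha b hb => ?_⟩
    · by_cases hik : i = k
      · subst hik; simpa using hT1.trans sdiff_subset
      · simpa [hik] using h1 i
    · by_cases hik : i = k
      · subst hik; simpa using hT2
      · simpa [hik] using h2 i ((mem_insert.1 hi).resolve_left hik)
    · by_cases hik : i = k
      · subst hik
        have hji : j ≠ i := hij.symm
        simp only [Function.update_self] at ha
        simp only [Function.update_of_ne hji] at hb
        exact (hTX j ((mem_insert.1 hj).resolve_left hji) b hb a ha).symm
      · simp only [Function.update_of_ne hik] at ha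
        have hiJ := (mem_insert.1 hi).resolve_left hik
        by_cases hjk : j = k
        · subst hjk
          simp only [Function.update_self] at hb
          exact hTX i hiJ a ha b hb
        · simp only [Function.update_of_ne hjk] at hb
          exact h3 i hiJ j ((mem_insert.1 hj).resolve_left hjk) hij a ha b hb

/-! ### Stability: `F`-free graphs of Turán minimum degree are `r`-colorable. -/

/-- Non-neighbor count of `v` in `A` (including `v` itself if `v ∈ A`). -/
noncomputable def nonNbrs {W : Type*} (G : SimpleGraph W) (A : Finset W) (v : W) : Finset W :=
  {a ∈ A | ¬ G.Adj v a}

lemma card_nbrs_add_card_nonNbrs {W : Type*} (G : SimpleGraph W) (A : Finset W) (v : W) :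
    #{a ∈ A | G.Adj v a} + #(nonNbrs G A v) = #A :=
  card_filter_add_card_filter_not _

lemma nonNbrs_disjoint_le {W : Type*} [Fintype W] (G : SimpleGraph W) {A B : Finset W}
    (h : Disjoint A B) (v : W) :
    #(nonNbrs G A v) + #(nonNbrs G B v) ≤ #(nonNbrs G univ v) := by
  rw [← card_union_of_disjoint]
  · apply card_le_card
    intro x
    simp [nonNbrs]
    tauto
  · exact disjoint_of_subset_left (filter_subset _ _)
      (disjoint_of_subset_right (filter_subset _ _) h)

/-- Stability of graphs of large minimum degree around a large complete `r`-partite subgraph: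
all but few vertices can be split into `r` independent sets. -/
lemma exists_independent_parts {V W : Type*} [Fintype V] [Fintype W] {F : SimpleGraph V}
    {G : SimpleGraph W} {r : ℕ} [NeZero r] (hF : ¬ F.Colorable r) {e : Sym2 V}
    (he : (F.deleteEdges {e}).Colorable r) (hfree : F.Free G) {t M : ℕ}
    (ht : t = Fintype.card V + 2) (hM : 0 < M) (A : Fin r → Finset W)
    (hA : ∀ i, #(A i) = 4 * t * M + t)
    (hadj : ∀ i j, i ≠ j → ∀ a ∈ A i, ∀ b ∈ A j, G.Adj a b)
    (hdeg : ∀ v, #(nonNbrs G univ v) ≤ Fintype.card W / r + 1)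
    (hn : r * (4 * t * M + t) ≤ t * Fintype.card W) :
    ∃ U : Fin r → Finset W, (∀ i, ∀ u ∈ U i, ∀ v ∈ U i, ¬ G.Adj u v) ∧
      (∀ i j, i ≠ j → Disjoint (U i) (U j)) ∧
      #(univ.biUnion U)ᶜ * M ≤ Fintype.card W := by
  set n := Fintype.card W with hn_def
  set s := 4 * t * M + t with hs
  have htpos : 0 < t := by omega
  -- Otherwise `v` has `t` neighbors in every `A i`; these form complete parts, and `v` with a
  -- neighbor in `A 0` supplies the critical edge.
  have h1 : ∀ v, ∃ i, s - t < #(nonNbrs G (A i) v) := by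
    intro v
    by_contra! h
    have hS : ∀ i, t ≤ #{a ∈ A i | G.Adj v a} := by
      intro i
      have := card_nbrs_add_card_nonNbrs G (A i) v
      have := h i
      have := hA i
      omega
    have hpos : 0 < #{a ∈ A 0 | G.Adj v a} := htpos.trans_le (hS 0)
    obtain ⟨y, hy⟩ := card_pos.1 hpos
    rw [mem_filter] at hy
    refine hfree (isContained_of_parts hF he (fun i => {a ∈ A i | G.Adj v a})
      (fun i => ht ▸ hS i) (fun i j hij a ha b hb => ?_) (i := 0) hy.2
      (fun j _ b hb => (mem_filter.1 hb).2) (fun j hj b hb => ?_))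
    · exact hadj i j hij a (mem_filter.1 ha).1 b (mem_filter.1 hb).1
    · exact hadj 0 j hj.symm y hy.1 b (mem_filter.1 hb).1
  choose c hc using h1
  -- Each vertex must miss more than `s - t` core vertices; a bad one misses over `2 * t * M` more
  -- than that. Double counting, with few non-neighbors per core vertex, makes bad vertices rare.
  let bad : Finset W := {v | s + (2 * t * M - t) < ∑ i, #(nonNbrs G (A i) v)}
  have hswap : ∑ v, ∑ i, #(nonNbrs G (A i) v) ≤ s * n + r * s := by
    rw [sum_comm]
    have : ∀ i, ∑ v, #(nonNbrs G (A i) v) ≤ s * (n / r + 1) := by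
      intro i
      have h2 : ∑ v, #(nonNbrs G (A i) v) = ∑ a ∈ A i, #(nonNbrs G univ a) := by
        simp only [nonNbrs, card_filter]
        rw [sum_comm]
        simp only [G.adj_comm]
      rw [h2, ← hA i, ← smul_eq_mul]
      exact sum_le_card_nsmul _ _ _ fun a _ => hdeg a
    calc ∑ i, ∑ v, #(nonNbrs G (A i) v) ≤ ∑ _i : Fin r, s * (n / r + 1) :=
          sum_le_sum fun i _ => this i
      _ = s * (r * (n / r)) + r * s := by simp; ring
      _ ≤ s * n + r * s := by gcongr; exact Nat.mul_div_le n r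
  have hMt : t ≤ 2 * t * M := by nlinarith
  have hbad : #bad * M ≤ n := by
    have h3 : n * (s - t) + #bad * (2 * t * M) ≤ ∑ v, ∑ i, #(nonNbrs G (A i) v) := by
      have : n * (s - t) + #bad * (2 * t * M) =
          ∑ v : W, ((s - t) + if v ∈ bad then 2 * t * M else 0) := by
        rw [sum_add_distrib, ← sum_filter]; simp [hn_def]
      rw [this]
      refine sum_le_sum fun v _ => ?_
      split_ifs with hv
      · have := (mem_filter.1 hv).2
        omega
      · have := (hc v).le.trans (single_le_sum (f := fun i => #(nonNbrs G (A i) v))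
          (fun _ _ => Nat.zero_le _) (mem_univ (c v)))
        omega
    have h4 : n * (s - t) + n * t = s * n := by
      rw [← mul_add, Nat.sub_add_cancel (by omega)]; ring
    have h5 : #bad * (2 * t * M) ≤ 2 * t * n := by
      have : r * s ≤ t * n := hn
      nlinarith
    have : (2 * t) * (#bad * M) ≤ (2 * t) * n := by linarith
    exact Nat.le_of_mul_le_mul_left this (by omega)
  refine ⟨fun i => {v | v ∉ bad ∧ c v = i}, ?_, ?_, ?_⟩
  · intro i u hu v hv huv
    rw [mem_filter] at hu hv
    have hfew : ∀ w, w ∉ bad → c w = i → ∀ j, j ≠ i → #(nonNbrs G (A j) w) ≤ 2 * t * M := by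
      intro w hw hwi j hj
      have h6 : #(nonNbrs G (A j) w) + #(nonNbrs G (A i) w) ≤ ∑ k, #(nonNbrs G (A k) w) :=
        add_le_sum (f := fun k => #(nonNbrs G (A k) w)) (fun _ _ => Nat.zero_le _)
          (mem_univ _) (mem_univ _) hj
      have h7 := hc w
      rw [hwi] at h7
      have h8 : ∑ k, #(nonNbrs G (A k) w) ≤ s + (2 * t * M - t) := by
        by_contra! h
        exact hw (mem_filter.2 ⟨mem_univ _, h⟩)
      omega
    -- Two good vertices of color `i` each miss at most `2 * t * M` of any other `A j`, so `t` of
    -- its `4 * t * M + t` vertices are common neighbors. An edge between them would create `F`.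
    refine hfree (isContained_of_parts hF he
      (fun j => if j = i then A i else {a ∈ A j | G.Adj u a ∧ G.Adj v a}) (fun j => ?_)
      (fun j k hjk a ha b hb => ?_) (i := i) huv (fun j hj b hb => ?_) (fun j hj b hb => ?_))
    · rw [← ht]
      by_cases hj : j = i
      · simp only [hj, if_true, hA]; omega
      · simp only [hj, if_false]
        have h9 : A j ⊆ {a ∈ A j | G.Adj u a ∧ G.Adj v a} ∪
            (nonNbrs G (A j) u ∪ nonNbrs G (A j) v) := by
          intro a ha
          simp only [nonNbrs, mem_union, mem_filter]
          tauto
        have h10 := (card_le_card h9).trans ((card_union_le _ _).trans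
          (Nat.add_le_add_left (card_union_le _ _) _))
        have h11 := hfew u hu.2.1 hu.2.2 j hj
        have h12 := hfew v hv.2.1 hv.2.2 j hj
        have h13 := hA j
        have h14 : s = 2 * t * M + 2 * t * M + t := by rw [hs]; ring
        omega
    · have hmem : ∀ j a, a ∈ (if j = i then A i else {a ∈ A j | G.Adj u a ∧ G.Adj v a}) →
          a ∈ A j := by
        intro j a ha
        split_ifs at ha with h
        · exact h ▸ ha
        · exact (mem_filter.1 ha).1
      exact hadj j k hjk a (hmem _ _ ha) b (hmem _ _ hb)
    · simp only [hj, if_false] at hb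
      exact (mem_filter.1 hb).2.1
    · simp only [hj, if_false] at hb
      exact (mem_filter.1 hb).2.2
  · intro i j hij
    rw [Finset.disjoint_left]
    intro v hv hv'
    exact hij ((mem_filter.1 hv).2.2.symm.trans (mem_filter.1 hv').2.2)
  · refine le_trans ?_ hbad
    gcongr
    intro v hv
    by_contra hvb
    simp [hvb] at hv

/-- An `F`-free graph of large minimum degree with `r` large independent sets covering almost
all vertices is `r`-colorable. -/
lemma colorable_of_independent_parts {V W : Type*} [Fintype V] [Fintype W] {F : SimpleGraph V}
    {G : SimpleGraph W} {r : ℕ} [NeZero r] (hF : ¬ F.Colorable r) {e : Sym2 V}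
    (he : (F.deleteEdges {e}).Colorable r) (hfree : F.Free G) {t E k : ℕ}
    (ht : t = Fintype.card V + 2) (hk : k = r * t) (U : Fin r → Finset W)
    (hind : ∀ i, ∀ u ∈ U i, ∀ v ∈ U i, ¬ G.Adj u v)
    (hdisj : ∀ i j, i ≠ j → Disjoint (U i) (U j))
    (hbad : #(univ.biUnion U)ᶜ ≤ E)
    (hdeg : ∀ v, #(nonNbrs G univ v) ≤ Fintype.card W / r + 1)
    (hE : r + t + 10 ≤ E) (hn : 9 * (k * E) + 12 * E ≤ Fintype.card W / r) :
    G.Colorable r := by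
  set n := Fintype.card W with hn_def
  set q := n / r with hq
  have hle : ∀ i, #(U i) ≤ q + 1 := by
    intro i
    rcases (U i).eq_empty_or_nonempty with h | ⟨v, hv⟩
    · simp [h]
    · refine (card_le_card ?_).trans (hdeg v)
      intro w hw
      simp only [nonNbrs, mem_filter, mem_univ, true_and]
      exact hind i v hv w hw
  have hge : ∀ i, q ≤ #(U i) + E + r := by
    intro i
    have h1 : n ≤ E + ∑ j, #(U j) := by
      have h := card_add_card_compl (univ.biUnion U)
      have h' : #(univ.biUnion U) ≤ ∑ j, #(U j) := card_biUnion_le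
      omega
    have h2 : ∑ j, #(U j) ≤ #(U i) + (r - 1) * (q + 1) := by
      rw [← add_sum_erase _ _ (mem_univ i)]
      gcongr
      refine (sum_le_card_nsmul _ _ (q + 1) fun j _ => hle j).trans ?_
      simp
    have h3 : r * q ≤ n := Nat.mul_div_le n r
    obtain ⟨m, rfl⟩ : ∃ m, r = m + 1 := ⟨r - 1, (Nat.succ_pred (NeZero.ne r)).symm⟩
    simp only [Nat.add_sub_cancel] at h2
    nlinarith
  have hnb : ∀ i v, ∀ j, j ≠ i → #(nonNbrs G (U j) v) + #(nonNbrs G (U i) v) ≤ q + 1 :=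
    fun i v j hji => (nonNbrs_disjoint_le G (hdisj j i hji) v).trans (hdeg v)
  -- A vertex of `U i` misses all of `U i`, which uses up nearly its whole allowance of `q + 1`
  -- non-neighbors.
  have hnear : ∀ i, ∀ v ∈ U i, ∀ j, j ≠ i → #(nonNbrs G (U j) v) ≤ 2 * E := by
    intro i v hv j hj
    have h1 := hnb i v j hj
    have h2 : nonNbrs G (U i) v = U i := by
      simp only [nonNbrs]
      exact filter_true_of_mem fun w hw => hind i v hv w hw
    rw [h2] at h1
    have := hge i
    omega
  have hgreedy : ∀ U' : Fin r → Finset W, (∀ i, U' i ⊆ U i) →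
      (∀ i, t + k * (2 * E) ≤ #(U' i)) → ∃ S : Fin r → Finset W, (∀ i, S i ⊆ U' i) ∧
        (∀ i, #(S i) = t) ∧ ∀ i j, i ≠ j → ∀ a ∈ S i, ∀ b ∈ S j, G.Adj a b := by
    intro U' hsub hU'
    refine exists_complete_parts (D := 2 * E) U' (fun i j hij a ha => ?_) (fun i => hk ▸ hU' i)
    refine (card_le_card ?_).trans (hnear i a (hsub i ha) j hij.symm)
    exact filter_subset_filter _ (hsub j)
  -- With many neighbors in every part, greedy selection inside the neighborhoods would give
  -- complete parts, and `w` joined to one of their vertices would complete `F`.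
  have hassign : ∀ w, ∃ i, #{a ∈ U i | G.Adj w a} < t + k * (2 * E) := by
    intro w
    by_contra! h
    obtain ⟨S, hS1, hS2, hS3⟩ := hgreedy _ (fun i => filter_subset _ _) h
    have hpos : 0 < #(S 0) := by rw [hS2]; omega
    obtain ⟨y, hy⟩ := card_pos.1 hpos
    exact hfree (isContained_of_parts hF he S (fun i => by rw [hS2, ht]) hS3 (i := 0)
      (mem_filter.1 (hS1 0 hy)).2 (fun j _ b hb => (mem_filter.1 (hS1 j hb)).2)
      (fun j hj b hb => hS3 0 j hj.symm y hy b hb))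
  choose c hc using hassign
  -- Having few neighbors in part `c w`, the vertex `w` spends almost all its non-neighbors there
  -- and is nearly complete to the others.
  have hc' : ∀ w j, j ≠ c w → #(nonNbrs G (U j) w) ≤ 2 * (k * E) + 3 * E := by
    intro w j hj
    have h1 := hnb (c w) w j hj
    have h2 := card_nbrs_add_card_nonNbrs G (U (c w)) w
    have h3 := hc w
    have h4 := hge (c w)
    have h5 : k * (2 * E) = 2 * (k * E) := by ring
    omega
  refine ⟨Coloring.mk c fun {u v} huv hcuv => ?_⟩
  let U' : Fin r → Finset W := fun j => if j = c u then U j else {a ∈ U j | G.Adj u a ∧ G.Adj v a}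
  have hU's : ∀ j, U' j ⊆ U j := by
    intro j
    simp only [U']
    split_ifs
    · exact Finset.Subset.refl _
    · exact filter_subset _ _
  obtain ⟨S, hS1, hS2, hS3⟩ := hgreedy U' hU's (by
    intro j
    have h5 : k * (2 * E) = 2 * (k * E) := by ring
    have h6 := hge j
    simp only [U']
    split_ifs with hj
    · omega
    · have h9 : U j ⊆ {a ∈ U j | G.Adj u a ∧ G.Adj v a} ∪
            (nonNbrs G (U j) u ∪ nonNbrs G (U j) v) := by
        intro a ha
        simp only [nonNbrs, mem_union, mem_filter]
        tauto
      have h10 := (card_le_card h9).trans ((card_union_le _ _).trans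
        (Nat.add_le_add_left (card_union_le _ _) _))
      have h11 := hc' u j hj
      have h12 := hc' v j (hcuv ▸ hj)
      omega)
  have hSadj : ∀ j, j ≠ c u → ∀ b ∈ S j, G.Adj u b ∧ G.Adj v b := by
    intro j hj b hb
    have := hS1 j hb
    simp only [U', hj, if_false] at this
    exact (mem_filter.1 this).2
  exact hfree (isContained_of_parts hF he S (fun i => by rw [hS2, ht]) hS3 (i := c u) huv
    (fun j hj b hb => (hSadj j hj b hb).1) (fun j hj b hb => (hSadj j hj b hb).2))

/-- For large `n`, `F`-free graphs with the minimum degree of the Turán graph are `r`-colorable. -/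
lemma eventually_colorable_of_degree {V : Type*} [Fintype V] {F : SimpleGraph V} {r : ℕ}
    (hr : 2 ≤ r) (hF : ¬ F.Colorable r) {e : Sym2 V} (he : (F.deleteEdges {e}).Colorable r) :
    ∀ᶠ n in atTop, ∀ G : SimpleGraph (Fin n), F.Free G →
      (∀ v, #(nonNbrs G univ v) ≤ n / r + 1) → G.Colorable r := by
  have : NeZero r := ⟨by omega⟩
  set t := Fintype.card V + 2 with ht
  set k := r * t with hk
  -- With `E = n / M` this gives `(9 * k + 12) * E ≤ n / r`, the size condition of
  -- `colorable_of_independent_parts`.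
  set M := r * (9 * k + 12) with hM
  have hMpos : 0 < M := by positivity
  set s := 4 * t * M + t with hs
  -- Half the gap between the densities `1 - 1/(r-1)` and `1 - 1/r`, so the minimum degree exceeds
  -- the Erdős–Stone threshold for a complete `r`-partite subgraph.
  set ε : ℝ := (1 / (r - 1 : ℕ) - 1 / r) / 2 with hε
  have hr1 : (0 : ℝ) < (r - 1 : ℕ) := by exact_mod_cast (by omega : 0 < r - 1)
  have hrr : ((r - 1 : ℕ) : ℝ) < r := by exact_mod_cast (by omega : r - 1 < r)
  have hεpos : 0 < ε := by
    rw [hε]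
    have := one_div_lt_one_div_of_lt hr1 hrr
    linarith
  have hES := eventually_completeEquipartiteGraph_isContained_of_minDegree hεpos (r - 1) s
  have hlim : ∀ᶠ n : ℕ in atTop, (1 : ℝ) ≤ ε * n := by
    have := (tendsto_natCast_atTop_atTop (R := ℝ)).const_mul_atTop hεpos
    exact this.eventually_ge_atTop 1
  filter_upwards [hES, hlim, eventually_ge_atTop (M * (r + t + 10)), eventually_ge_atTop (r * s),
    eventually_ge_atTop 1] with n h1 h2 h3 h4 h5 G hfree hdeg
  have hcont : completeEquipartiteGraph (r - 1 + 1) s ⊑ G := by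
    apply h1
    have : Nonempty (Fin n) := ⟨⟨0, h5⟩⟩
    obtain ⟨v, hv⟩ := G.exists_minimal_degree_vertex
    rw [hv]
    have hd : n ≤ G.degree v + (n / r + 1) := by
      have ha := card_nbrs_add_card_nonNbrs G univ v
      have hb := hdeg v
      rw [← card_neighborFinset_eq_degree, neighborFinset_eq_filter]
      rw [card_univ, Fintype.card_fin] at ha
      convert! (by omega : n ≤ #{a | G.Adj v a} + (n / r + 1))
    have hd' : (n : ℝ) ≤ G.degree v + (n / r + 1) := by
      have : ((n / r : ℕ) : ℝ) ≤ n / r := Nat.cast_div_le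
      have hd2 : (n : ℝ) ≤ G.degree v + ((n / r : ℕ) + 1) := by exact_mod_cast hd
      linarith
    have : (1 - 1 / ((r - 1 : ℕ) : ℝ) + ε) * n = n - n / r - ε * n := by
      rw [hε]; ring
    rw [ge_iff_le, this]
    linarith
  rw [Nat.sub_add_cancel (by omega : 1 ≤ r)] at hcont
  obtain ⟨f⟩ := hcont
  obtain ⟨U, hU1, hU2, hU3⟩ := exists_independent_parts hF he hfree ht hMpos
    (fun i => univ.image fun j => f (i, j))
    (fun i => by
      have hinj : Function.Injective fun j => f (i, j) :=
        fun a b hab => (Prod.ext_iff.1 (f.injective hab)).2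
      rw [card_image_of_injective _ hinj, card_univ, Fintype.card_fin])
    (fun i j hij a ha b hb => by
      simp only [mem_image, mem_univ, true_and] at ha hb
      obtain ⟨a', rfl⟩ := ha
      obtain ⟨b', rfl⟩ := hb
      exact f.toHom.map_adj (completeEquipartiteGraph_adj.2 hij))
    (by simpa using hdeg)
    (by
      rw [Fintype.card_fin]
      nlinarith)
  rw [Fintype.card_fin] at hU3
  refine colorable_of_independent_parts hF he hfree (E := n / M) ht hk U hU1 hU2
    ((Nat.le_div_iff_mul_le hMpos).2 hU3) (by simpa using hdeg)
    ((Nat.le_div_iff_mul_le hMpos).2 (by rw [mul_comm]; exact h3)) ?_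
  rw [Fintype.card_fin, Nat.le_div_iff_mul_le (by omega)]
  calc (9 * (k * (n / M)) + 12 * (n / M)) * r = M * (n / M) := by rw [hM]; ring
    _ ≤ n := Nat.mul_div_le n M

/-! ### Complete multipartite graphs, Turán graphs and Simonovits' theorem. -/

/-- The complete multipartite graph whose parts are the fibers of `p`. -/
def multipartite {W ι : Type*} (p : W → ι) : SimpleGraph W := (⊤ : SimpleGraph ι).comap p

lemma multipartite_adj {W ι : Type*} {p : W → ι} {v w : W} :
    (multipartite p).Adj v w ↔ p v ≠ p w := Iff.rfl

/-- The sizes of the fibers of `p`. -/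
noncomputable def partSize {W ι : Type*} [Fintype W] (p : W → ι) (i : ι) : ℕ := #{w | p w = i}

lemma sum_partSize {W ι : Type*} [Fintype W] [Fintype ι] (p : W → ι) :
    ∑ i, partSize p i = Fintype.card W := by
  rw [← card_univ, card_eq_sum_card_fiberwise (f := p) (t := univ) (by simp)]
  rfl

/-- A vertex is non-adjacent exactly to its own part. Edge counts are thereby compared through sums
of squares of part sizes. -/
lemma two_mul_card_edges_multipartite {W ι : Type*} [Fintype W] [Fintype ι] (p : W → ι) :
    2 * #(multipartite p).edgeFinset + ∑ i, partSize p i ^ 2 = Fintype.card W ^ 2 := by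
  rw [← sum_degrees_eq_twice_card_edges]
  have h1 : ∑ i, partSize p i ^ 2 = ∑ v, partSize p (p v) := by
    rw [← sum_fiberwise (s := univ) (g := p)]
    refine sum_congr rfl fun i _ => ?_
    rw [sum_congr rfl fun v hv => by rw [(mem_filter.1 hv).2], sum_const, smul_eq_mul, sq]
    rfl
  rw [h1, ← sum_add_distrib]
  have h2 : ∀ v, (multipartite p).degree v + partSize p (p v) = Fintype.card W := by
    intro v
    rw [← card_neighborFinset_eq_degree, neighborFinset_eq_filter, partSize, add_comm, ← card_univ]
    rw [← card_filter_add_card_filter_not (s := (univ : Finset W)) fun w => p w = p v]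
    simp [multipartite_adj, eq_comm]
  rw [sum_congr rfl fun v _ => h2 v]
  simp [sq]

/-- The partition of `Fin n` into residue classes modulo `r`. -/
def residue (n r : ℕ) [NeZero r] (v : Fin n) : Fin r := Fin.ofNat r v

lemma turanGraph_eq_multipartite (n r : ℕ) [NeZero r] :
    turanGraph n r = multipartite (residue n r) := by
  ext v w
  rw [turanGraph_adj, multipartite_adj, residue, residue, Ne, Ne, Fin.ext_iff]
  simp

/-- The larger parts come first: part 0 is always a largest one and part `r - 1` a smallest one. -/
lemma partSize_residue (n r : ℕ) [NeZero r] (i : Fin r) :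
    partSize (residue n r) i = n / r + if (i : ℕ) < n % r then 1 else 0 := by
  have h := Nat.count_modEq_card n (NeZero.pos r) (i : ℕ)
  rw [Nat.mod_eq_of_lt i.2] at h
  rw [← h, Nat.count_eq_card_filter_range, partSize, card_filter, card_filter,
    ← Fin.sum_univ_eq_sum_range (fun v => if v ≡ i [MOD r] then 1 else 0)]
  refine sum_congr rfl fun v _ => ?_
  simp [residue, Fin.ext_iff, Nat.ModEq, Nat.mod_eq_of_lt i.2]

/-- The new vertex `n` joins the class of `n` mod `r`, which so far has exactly `n / r` vertices. -/
lemma card_edges_turanGraph_succ (n r : ℕ) [NeZero r] :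
    #(turanGraph (n + 1) r).edgeFinset + n / r = #(turanGraph n r).edgeFinset + n := by
  have h1 := two_mul_card_edges_multipartite (residue n r)
  have h2 := two_mul_card_edges_multipartite (residue (n + 1) r)
  have h3 : ∀ i, partSize (residue (n + 1) r) i =
      partSize (residue n r) i + if i = Fin.ofNat r n then 1 else 0 := by
    intro i
    rw [partSize, partSize, card_filter, Fin.sum_univ_castSucc, card_filter]
    simp [residue, eq_comm]
  have h4 : ∑ i, partSize (residue (n + 1) r) i ^ 2 =
      ∑ i, partSize (residue n r) i ^ 2 + (2 * (n / r) + 1) := by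
    have h5 : partSize (residue n r) (Fin.ofNat r n) = n / r := by
      rw [partSize_residue]; simp
    rw [← h5]
    have : ∀ i, partSize (residue (n + 1) r) i ^ 2 = partSize (residue n r) i ^ 2 +
        if i = Fin.ofNat r n then 2 * partSize (residue n r) i + 1 else 0 := by
      intro i
      rw [h3]
      split_ifs <;> ring
    rw [sum_congr rfl fun i _ => this i, sum_add_distrib]
    simp
  simp only [Fintype.card_fin] at h1 h2
  have e1 : #(turanGraph n r).edgeFinset = #(multipartite (residue n r)).edgeFinset := by
    congr! 2; exact turanGraph_eq_multipartite n r
  have e2 : #(turanGraph (n + 1) r).edgeFinset =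
      #(multipartite (residue (n + 1) r)).edgeFinset := by
    congr! 2; exact turanGraph_eq_multipartite (n + 1) r
  rw [e1, e2]
  nlinarith

lemma free_turanGraph {V : Type*} {F : SimpleGraph V} {r : ℕ} [NeZero r]
    (hF : ¬ F.Colorable r) (n : ℕ) : F.Free (turanGraph n r) := by
  rintro ⟨f⟩
  rw [turanGraph_eq_multipartite] at f
  exact hF ⟨Coloring.mk (fun v => residue n r (f v)) fun {u v} huv => f.toHom.map_adj huv⟩

lemma isTuranMaximal_of_colorable {n r : ℕ} [NeZero r] {G : SimpleGraph (Fin n)}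
    (hG : G.Colorable r) (he : #(turanGraph n r).edgeFinset ≤ #G.edgeFinset) :
    G.IsTuranMaximal r := by
  have hT : (turanGraph n r).IsTuranMaximal r := isTuranMaximal_turanGraph (NeZero.pos r)
  exact ⟨hG.cliqueFree (Nat.lt_succ_self r), fun G' _ hG' => (hT.2 hG').trans (by convert! he)⟩

/-- Surplus of the extremal number decreases as long as it is positive. -/
lemma eventually_surplus_decreasing {V : Type*} [Fintype V] {F : SimpleGraph V} {r : ℕ}
    (hr : 2 ≤ r) [NeZero r] (hF : ¬ F.Colorable r) {e : Sym2 V}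
    (he : (F.deleteEdges {e}).Colorable r) :
    ∀ᶠ n in atTop, ∀ G : SimpleGraph (Fin (n + 1)), F.Free G → ¬ G.Colorable r →
      #G.edgeFinset + #(turanGraph n r).edgeFinset + 1 ≤
        extremalNumber n F + #(turanGraph (n + 1) r).edgeFinset := by
  filter_upwards [(tendsto_add_atTop_nat 1).eventually (eventually_colorable_of_degree hr hF he)]
    with n h G hfree hcol
  -- A vertex with this many non-neighbors has degree at most `n - n / r - 1`, one less than the
  -- Turán graph gains from `n` to `n + 1`; deleting it gives the claim.
  have h1 : ∃ v, (n + 1) / r + 1 < #(nonNbrs G univ v) := by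
    by_contra! h'
    exact hcol (h G hfree h')
  obtain ⟨v, hv⟩ := h1
  have h2 := card_edgeFinset_deleteIncidenceSet_le_extremalNumber hfree v
  have h3 := G.card_edgeFinset_deleteIncidenceSet v
  have h4 := card_edges_turanGraph_succ n r
  have h5 := card_nbrs_add_card_nonNbrs G univ v
  have h6 : #{a | G.Adj v a} = G.degree v := by
    rw [← card_neighborFinset_eq_degree, neighborFinset_eq_filter]
  rw [card_univ, Fintype.card_fin] at h5
  rw [Fintype.card_fin, Nat.add_sub_cancel] at h2
  have h7 : n / r ≤ (n + 1) / r := Nat.div_le_div_right (Nat.le_succ n)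
  omega

/-- **Simonovits' theorem** on color-critical graphs. -/
theorem eventually_iso_turanGraph {V : Type*} [Fintype V] {F : SimpleGraph V} {r : ℕ}
    (hr : 2 ≤ r) [NeZero r] (hF : ¬ F.Colorable r) {e : Sym2 V}
    (he : (F.deleteEdges {e}).Colorable r) :
    ∀ᶠ n in atTop, extremalNumber n F = #(turanGraph n r).edgeFinset ∧
      ∀ G : SimpleGraph (Fin n), F.Free G → #G.edgeFinset = extremalNumber n F →
        Nonempty (G ≃g turanGraph n r) := by
  have hbot : F ≠ ⊥ := by
    rintro rfl
    exact hF ⟨Coloring.mk (fun _ => 0) (by simp)⟩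
  have hge : ∀ n, #(turanGraph n r).edgeFinset ≤ extremalNumber n F := by
    intro n
    have := card_edgeFinset_le_extremalNumber (free_turanGraph hF n)
    rw [Fintype.card_fin] at this
    convert! this
  obtain ⟨N, hN⟩ := eventually_atTop.1 (eventually_surplus_decreasing hr hF he)
  have hcol : ∀ n, ∀ G : SimpleGraph (Fin n), G.Colorable r →
      #G.edgeFinset ≤ #(turanGraph n r).edgeFinset := by
    intro n G hG
    have hT : (turanGraph n r).IsTuranMaximal r := isTuranMaximal_turanGraph (NeZero.pos r)
    convert! hT.2 (hG.cliqueFree (Nat.lt_succ_self r))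
  -- The surplus of the extremal number over the Turán number either is gone at `n + 1` or drops by
  -- at least one, so it vanishes after finitely many steps.
  have hstep : ∀ n ≥ N, extremalNumber (n + 1) F ≤ #(turanGraph (n + 1) r).edgeFinset ∨
      extremalNumber (n + 1) F + #(turanGraph n r).edgeFinset + 1 ≤
        extremalNumber n F + #(turanGraph (n + 1) r).edgeFinset := by
    intro n hn
    obtain ⟨G, _, hG⟩ := exists_isExtremal_free (V := Fin (n + 1)) hbot
    have h1 := card_edgeFinset_of_isExtremal_free hG
    rw [Fintype.card_fin] at h1
    have h1' : #G.edgeFinset = extremalNumber (n + 1) F := by convert! h1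
    by_cases hc : G.Colorable r
    · left
      rw [← h1']
      convert! hcol _ G hc
    · right
      rw [← h1']
      convert! hN n hn G hG.1 hc
  have hdec : ∀ m, extremalNumber (N + m) F ≤ #(turanGraph (N + m) r).edgeFinset +
      (extremalNumber N F - m) := by
    intro m
    induction m with
    | zero => simp
    | succ m ih =>
      rw [← add_assoc]
      have := hstep (N + m) (by omega)
      omega
  have hex : ∀ n ≥ N + extremalNumber N F, extremalNumber n F = #(turanGraph n r).edgeFinset := by
    intro n hn
    obtain ⟨m, rfl⟩ := Nat.exists_eq_add_of_le (show N ≤ n by omega)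
    have := hdec m
    have := hge (N + m)
    omega
  filter_upwards [eventually_ge_atTop (N + extremalNumber N F + 1)] with n hn
  obtain ⟨n, rfl⟩ : ∃ m, n = m + 1 := ⟨n - 1, by omega⟩
  refine ⟨hex _ (by omega), fun G hfree hG => ?_⟩
  -- With zero surplus at both orders the strict drop is impossible, which gives uniqueness through
  -- Turán's theorem.
  have hc : G.Colorable r := by
    by_contra hc
    have h1 := hN n (by omega) G hfree hc
    rw [hG, hex n (by omega), hex (n + 1) (by omega)] at h1
    omega
  have := (isTuranMaximal_of_colorable hc (by rw [hG, hex (n + 1) (by omega)])).nonempty_iso_turanGraph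
  rwa [Fintype.card_fin] at this

/-! ### Labelled copies, and the polynomial c as a count of embeddings. -/

lemma toSubgraph_adj_iff {V W : Type*} {F : SimpleGraph V} {G : SimpleGraph W} (f : F.Copy G)
    (x y : W) : f.toSubgraph.Adj x y ↔ ∃ a b, F.Adj a b ∧ f a = x ∧ f b = y := Iff.rfl

lemma mem_verts_toSubgraph_iff {V W : Type*} {F : SimpleGraph V} {G : SimpleGraph W}
    (f : F.Copy G) (x : W) : x ∈ f.toSubgraph.verts ↔ ∃ a, f a = x := by
  simp

/-- Labelled copies come in classes of size `|Aut F|`. -/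
lemma labelledCopyCount_eq {V W : Type*} [Fintype V] [Fintype W] (F : SimpleGraph V)
    (G : SimpleGraph W) :
    G.labelledCopyCount F = Nat.card (F ≃g F) * G.copyCount F := by
  rw [copyCount_eq_card_image_copyToSubgraph, labelledCopyCount, ← Finset.card_univ,
    card_eq_sum_card_image Copy.toSubgraph, mul_comm]
  refine sum_const_nat fun H hH => ?_
  obtain ⟨f, -, rfl⟩ := mem_image.1 hH
  let _ : Fintype (F ≃g F) :=
    Fintype.ofInjective (fun σ : F ≃g F => (σ : V → V)) DFunLike.coe_injective
  rw [Nat.card_eq_fintype_card, ← Finset.card_univ]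
  symm
  -- Two labelled copies with the same image differ by an automorphism of `F`.
  refine card_bij (fun σ _ => f.comp σ.toCopy) (fun σ _ => ?_) (fun σ _ τ _ h => ?_)
    (fun g hg => ?_)
  · rw [mem_filter]
    refine ⟨mem_univ _, Subgraph.ext (Set.ext fun x => ?_) ?_⟩
    · rw [mem_verts_toSubgraph_iff, mem_verts_toSubgraph_iff]
      exact ⟨fun ⟨a, ha⟩ => ⟨σ a, ha⟩, fun ⟨a, ha⟩ => ⟨σ.symm a, by simpa using ha⟩⟩
    · ext x y
      rw [toSubgraph_adj_iff, toSubgraph_adj_iff]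
      constructor
      · rintro ⟨a, b, hab, rfl, rfl⟩
        exact ⟨σ a, σ b, σ.map_adj_iff.2 hab, rfl, rfl⟩
      · rintro ⟨a, b, hab, rfl, rfl⟩
        exact ⟨σ.symm a, σ.symm b, σ.symm.map_adj_iff.2 hab, by simp, by simp⟩
  · ext v
    exact f.injective (DFunLike.congr_fun h v)
  · have hgf := (mem_filter.1 hg).2
    have hv : ∀ v, ∃ w, f w = g v := fun v => by
      rw [← mem_verts_toSubgraph_iff, ← hgf, mem_verts_toSubgraph_iff]
      exact ⟨v, rfl⟩
    choose σ hσ using hv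
    have hinj : Function.Injective σ := fun a b hab =>
      g.injective ((hσ a).symm.trans ((congrArg f hab).trans (hσ b)))
    have hadj : ∀ a b, F.Adj (σ a) (σ b) ↔ F.Adj a b := by
      intro a b
      have h1 : ∀ (k : F.Copy G) a b, k.toSubgraph.Adj (k a) (k b) ↔ F.Adj a b := by
        intro k a b
        rw [toSubgraph_adj_iff]
        constructor
        · rintro ⟨a', b', h, ha, hb⟩
          rwa [← k.injective ha, ← k.injective hb]
        · intro h
          exact ⟨a, b, h, rfl, rfl⟩
      rw [← h1 f, ← h1 g, hσ, hσ, hgf]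
    refine ⟨⟨Equiv.ofBijective σ (Finite.injective_iff_bijective.1 hinj), hadj _ _⟩,
      mem_univ _, ?_⟩
    ext v
    exact hσ v

/-- An embedding that respects the labels is an independent choice of an embedding on each fiber. -/
lemma card_embeddings_fiberwise {A B ι : Type*} [Fintype A] [Fintype B] [Fintype ι]
    (a : A → ι) (b : B → ι) :
    Fintype.card {φ : A ↪ B // ∀ v, b (φ v) = a v} =
      ∏ i, (partSize b i).descFactorial (partSize a i) := by
  let E : {φ : A ↪ B // ∀ v, b (φ v) = a v} ≃ ∀ i, ({v // a v = i} ↪ {w // b w = i}) :=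
    { toFun := fun φ i => ⟨fun v => ⟨φ.1 v, (φ.2 v).trans v.2⟩, fun v w h =>
        Subtype.ext (φ.1.injective (Subtype.ext_iff.1 h))⟩
      invFun := fun g => ⟨⟨fun v => (g (a v) ⟨v, rfl⟩).1, fun v w h => by
          have hv := (g (a v) ⟨v, rfl⟩).2
          have hw := (g (a w) ⟨w, rfl⟩).2
          have hvw : a v = a w := by
            simp only at h
            rw [← hv, ← hw, h]
          have key : ∀ i j (hi : a v = i) (hj : a w = j) (_ : i = j),
              (g i ⟨v, hi⟩).1 = (g j ⟨w, hj⟩).1 → v = w := by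
            rintro i _ hi hj rfl h
            exact congrArg Subtype.val ((g i).injective (Subtype.ext h))
          exact key _ _ rfl rfl hvw h⟩, fun v => (g (a v) ⟨v, rfl⟩).2⟩
      left_inv := fun φ => by ext v; rfl
      right_inv := fun g => by
        funext i
        ext ⟨v, rfl⟩
        rfl }
  rw [Fintype.card_congr E, Fintype.card_pi]
  refine prod_congr rfl fun i _ => ?_
  rw [Fintype.card_embedding_eq, Fintype.card_subtype, Fintype.card_subtype]
  rfl

/-- Embeddings with two prescribed values and prescribed parts for all other vertices. -/
lemma card_embeddings_two_prescribed {V W ι : Type*} [Fintype V] [Fintype W] [Fintype ι]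
    (χ : V → ι) (p : W → ι) {u v : V} {x y : W} (huv : u ≠ v) (hxy : x ≠ y)
    (hx : p x = χ u) (hy : p y = χ v) :
    #{φ : V ↪ W | φ u = x ∧ φ v = y ∧ ∀ w, p (φ w) = χ w} =
      ∏ i, (partSize (fun z : {z // z ≠ x ∧ z ≠ y} => p z) i).descFactorial
        (partSize (fun w : {w // w ≠ u ∧ w ≠ v} => χ w) i) := by
  rw [← card_embeddings_fiberwise, ← Fintype.card_coe]
  refine Fintype.card_congr ?_
  refine
    { toFun := fun φ => ⟨⟨fun w => ⟨φ.1 w, ?_⟩, ?_⟩, ?_⟩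
      invFun := fun g => ⟨⟨fun w => if h : w ≠ u ∧ w ≠ v then (g.1 ⟨w, h⟩).1 else
        if w = u then x else y, ?_⟩, ?_⟩
      left_inv := ?_
      right_inv := ?_ }
  · have := (mem_filter.1 φ.2).2
    exact ⟨fun h => w.2.1 (φ.1.injective (h.trans this.1.symm)),
      fun h => w.2.2 (φ.1.injective (h.trans this.2.1.symm))⟩
  · intro a b hab
    exact Subtype.ext (φ.1.injective (Subtype.ext_iff.1 hab))
  · intro w
    exact (mem_filter.1 φ.2).2.2.2 w
  · intro a b hab
    by_cases ha : a ≠ u ∧ a ≠ v <;> by_cases hb : b ≠ u ∧ b ≠ v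
    · simp only [dif_pos ha, dif_pos hb] at hab
      exact Subtype.ext_iff.1 (g.1.injective (Subtype.ext hab))
    · have := (g.1 ⟨a, ha⟩).2
      simp only [dif_pos ha, dif_neg hb] at hab
      split_ifs at hab
      · exact absurd hab this.1
      · exact absurd hab this.2
    · have := (g.1 ⟨b, hb⟩).2
      simp only [dif_neg ha, dif_pos hb] at hab
      split_ifs at hab
      · exact absurd hab.symm this.1
      · exact absurd hab.symm this.2
    · simp only [dif_neg ha, dif_neg hb] at hab
      split_ifs at hab with h1 h2 h2
      · rw [h1, h2]
      · exact absurd hab hxy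
      · exact absurd hab hxy.symm
      · have ha' : a = v := by tauto
        have hb' : b = v := by tauto
        rw [ha', hb']
  · rw [mem_filter]
    refine ⟨mem_univ _, ?_, ?_, ?_⟩
    · simp
    · simp [huv.symm]
    · intro w
      change p (if h : w ≠ u ∧ w ≠ v then (g.1 ⟨w, h⟩).1 else if w = u then x else y) = χ w
      split_ifs with h1 h2
      · exact g.2 ⟨w, h1⟩
      · rw [h2, hx]
      · have : w = v := by tauto
        rw [this, hy]
  · intro φ
    have := (mem_filter.1 φ.2).2
    ext w
    simp only [Function.Embedding.coeFn_mk]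
    split_ifs with h1 h2
    · rfl
    · rw [h2, this.1]
    · have h3 : w = v := by tauto
      rw [h3, this.2.1]
  · intro g
    ext w
    simp [w.2.1, w.2.2]

/-- The edges of `F` that an embedding maps inside a part. -/
noncomputable def monoEdges {V W ι : Type*} [Fintype V] (F : SimpleGraph V) (p : W → ι)
    (φ : V ↪ W) : Finset (Sym2 V) :=
  {e | e ∈ F.edgeSet ∧ (e.map fun v => p (φ v)).IsDiag}

lemma mem_monoEdges {V W ι : Type*} [Fintype V] {F : SimpleGraph V} {p : W → ι} {φ : V ↪ W}
    {e : Sym2 V} :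
    e ∈ monoEdges F p φ ↔ e ∈ F.edgeSet ∧ (e.map fun v => p (φ v)).IsDiag := by
  simp [monoEdges]

/-- The embeddings of `F` having a single edge inside a part, mapped to `b`. -/
noncomputable def singleMono {V W ι : Type*} [Fintype V] [Fintype W] (F : SimpleGraph V)
    (p : W → ι) (b : Sym2 W) : Finset (V ↪ W) :=
  {φ | ∃ e, monoEdges F p φ = {e} ∧ e.map φ = b}

/-- Deleting an edge of a graph that is not `r`-colorable lowers the chromatic number by at
most one. -/
lemma isCriticalEdge_of_colorable {V : Type*} [Finite V] {F : SimpleGraph V} {r : ℕ} {e : Sym2 V}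
    (hF : ¬ F.Colorable r) (he : e ∈ F.edgeSet) (hc : (F.deleteEdges {e}).Colorable r) :
    IsCriticalEdge F r e := by
  refine ⟨he, le_antisymm hc.chromaticNumber_le ?_⟩
  rw [le_chromaticNumber_iff_colorable]
  intro m hm
  by_contra! hlt
  induction e with
  | _ u v =>
  obtain ⟨χ⟩ := hm
  -- With fewer than `r` colors on `F - e`, a fresh color for one end of `e` would color `F` with at
  -- most `r`.
  refine hF (Colorable.mono (n := m + 1) hlt ?_)
  refine ⟨Coloring.mk (fun w => if w = u then Fin.last m else (χ w).castSucc) ?_⟩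
  intro a b hab
  have hne := hab.ne
  by_cases ha : a = u
  · subst ha
    simp [hne.symm, (Fin.castSucc_lt_last _).ne']
  · by_cases hb : b = u
    · subst hb
      simp [hne, (Fin.castSucc_lt_last _).ne]
    · simp only [ha, hb, if_false, ne_eq, Fin.castSucc_inj]
      refine χ.valid (deleteEdges_adj.2 ⟨hab, ?_⟩)
      simp [ha, hb]

lemma partSize_subtype {W ι : Type*} [Fintype W] (P : W → Prop) [DecidablePred P]
    (p : W → ι) (i : ι) :
    partSize (fun z : {z // P z} => p z) i = #{z | P z ∧ p z = i} := by
  rw [partSize]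
  refine card_bij (fun z _ => z.1) (fun z hz => ?_) (fun _ _ _ _ h => Subtype.ext h)
    fun z hz => ?_
  · have := (mem_filter.1 hz).2
    exact mem_filter.2 ⟨mem_univ _, z.2, this⟩
  · have := (mem_filter.1 hz).2
    exact ⟨⟨z, this.1⟩, mem_filter.2 ⟨mem_univ _, this.2⟩, rfl⟩

lemma partSize_ne_ne {W : Type*} [Fintype W] {r : ℕ} [NeZero r] (p : W → Fin r) {x y : W}
    (hxy : x ≠ y) (hx : p x = 0) (hy : p y = 0) (i : Fin r) :
    partSize (fun z : {z // z ≠ x ∧ z ≠ y} => p z) i =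
      partSize p i - if i = 0 then 2 else 0 := by
  rw [partSize_subtype]
  split_ifs with hi
  · subst hi
    trans #((({z | p z = 0} : Finset W).erase x).erase y)
    · congr 1
      ext z
      simp
      tauto
    rw [card_erase_of_mem, card_erase_of_mem]
    · rw [Nat.sub_sub, partSize]
      congr!
    · simp [hx]
    · simp [hy, hxy.symm]
  · rw [partSize, Nat.sub_zero]
    congr 1
    ext z
    simp only [mem_filter, mem_univ, true_and, and_iff_right_iff_imp]
    intro hz
    constructor <;> rintro rfl
    · exact hi (hz.symm.trans hx)
    · exact hi (hz.symm.trans hy)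

/-- The number of embeddings with a given coloring that map the edge `e` to `s(x, y)`. -/
lemma card_embeddings_of_coloring {V W : Type*} [Fintype V] [Fintype W] {r : ℕ} [NeZero r]
    (χ : V → Fin r) (p : W → Fin r) {e : Sym2 V} (he : ¬ e.IsDiag) (hχ : ∀ w ∈ e, χ w = 0)
    {x y : W} (hxy : x ≠ y) (hx : p x = 0) (hy : p y = 0) :
    #{φ : V ↪ W | e.map φ = s(x, y) ∧ ∀ w, p (φ w) = χ w} =
      2 * ∏ i, (partSize p i - if i = 0 then 2 else 0).descFactorial
        #{w | w ∉ e ∧ χ w = i} := by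
  induction e with
  | _ u v =>
  have huv : u ≠ v := he
  have hu : χ u = 0 := hχ u (by simp)
  have hv : χ v = 0 := hχ v (by simp)
  -- The two orientations of `e` onto `s(x, y)` account for the factor 2 in c.
  have h1 : ({φ : V ↪ W | s(u, v).map φ = s(x, y) ∧ ∀ w, p (φ w) = χ w} : Finset (V ↪ W)) =
      ({φ : V ↪ W | φ u = x ∧ φ v = y ∧ ∀ w, p (φ w) = χ w} : Finset (V ↪ W)) ∪
      ({φ : V ↪ W | φ u = y ∧ φ v = x ∧ ∀ w, p (φ w) = χ w} : Finset (V ↪ W)) := by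
    ext φ
    simp only [mem_filter, mem_univ, true_and, mem_union, Sym2.map_mk, Sym2.eq_iff]
    tauto
  have h2 : ∀ x' y', x' ≠ y' → p x' = 0 → p y' = 0 →
      #{φ : V ↪ W | φ u = x' ∧ φ v = y' ∧ ∀ w, p (φ w) = χ w} =
        ∏ i, (partSize p i - if i = 0 then 2 else 0).descFactorial
          #{w | w ∉ s(u, v) ∧ χ w = i} := by
    intro x' y' hne hx' hy'
    have := card_embeddings_two_prescribed χ p huv hne (hx'.trans hu.symm) (hy'.trans hv.symm)
    simp only [partSize_ne_ne p hne hx' hy', partSize_subtype] at this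
    convert! this using 5
    simp
  rw [h1, card_union_of_disjoint, h2 x y hxy hx hy, h2 y x hxy.symm hy hx, two_mul]
  · rw [Finset.disjoint_left]
    intro φ h h'
    exact hxy ((mem_filter.1 h).2.1.symm.trans (mem_filter.1 h').2.1)

/-- Here `2 ≤ n 0` makes the truncated subtraction agree with the one in the polynomial. -/
lemma eval_cPoly {V : Type*} [Fintype V] (F : SimpleGraph V) (r : ℕ) [r.AtLeastTwo]
    (n : Fin r → ℕ) (hn : 2 ≤ n 0) :
    (Nat.card (F ≃g F) : ℝ) * MvPolynomial.eval (fun i => (n i : ℝ)) (cPoly F r) =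
      ((∑ e : Sym2 V with IsCriticalEdge F r e,
        ∑ χ : (F.deleteEdges {e}).Coloring (Fin r) with ∀ w ∈ e, χ w = 0,
          2 * ∏ i, (n i - if i = 0 then 2 else 0).descFactorial #{w | w ∉ e ∧ χ w = i} : ℕ) : ℝ) := by
  have hA : (Nat.card (F ≃g F) : ℝ) ≠ 0 := by
    have : Finite (F ≃g F) := Finite.of_injective (fun σ : F ≃g F => (σ : V → V)) DFunLike.coe_injective
    have : Nonempty (F ≃g F) := ⟨Iso.refl⟩
    exact_mod_cast Nat.card_pos.ne'
  rw [cPoly, map_mul, MvPolynomial.eval_C, ← mul_assoc, mul_one_div_cancel hA, one_mul, map_sum]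
  push_cast
  refine sum_congr rfl fun e _ => ?_
  rw [map_sum]
  refine sum_congr rfl fun χ _ => ?_
  rw [map_mul, map_prod, map_ofNat]
  congr 1
  refine prod_congr rfl fun i _ => ?_
  rw [← MvPolynomial.coe_aeval_eq_eval, RingHom.coe_coe, ← Polynomial.aeval_algHom_apply,
    Polynomial.coe_aeval_eq_eval, ← descPochhammer_eval_eq_descFactorial ℝ]
  congr 1
  split_ifs with hi
  · subst hi
    simp [Nat.cast_sub hn]
  · simp

/-- The number of copies of `F` that use exactly the edge `b` inside the first part. -/
lemma card_singleMono {V W : Type*} [Fintype V] [Fintype W] {F : SimpleGraph V} {r : ℕ}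
    [r.AtLeastTwo] (hF : ¬ F.Colorable r) (p : W → Fin r) {b : Sym2 W} (hb : ¬ b.IsDiag)
    (hp : ∀ x ∈ b, p x = 0) :
    (#(singleMono F p b) : ℝ) = (Nat.card (F ≃g F) : ℝ) *
      MvPolynomial.eval (fun i => (partSize p i : ℝ)) (cPoly F r) := by
  induction b with
  | _ x y =>
  have hxy : x ≠ y := hb
  have hx : p x = 0 := hp x (by simp)
  have hy : p y = 0 := hp y (by simp)
  have h2 : 2 ≤ partSize p 0 := by
    rw [← card_pair hxy]
    apply card_le_card
    intro z hz
    rcases mem_insert.1 hz with rfl | hz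
    · simp [hx]
    · rw [mem_singleton.1 hz]; simp [hy]
  rw [eval_cPoly F r _ h2, Nat.cast_inj]
  have h3 : ∀ e : Sym2 V, IsCriticalEdge F r e → ∀ χ : (F.deleteEdges {e}).Coloring (Fin r),
      (∀ w ∈ e, χ w = 0) → #{φ : V ↪ W | e.map φ = s(x, y) ∧ ∀ w, p (φ w) = χ w} =
      2 * ∏ i, (partSize p i - if i = 0 then 2 else 0).descFactorial
        #{w | w ∉ e ∧ χ w = i} :=
    fun e he χ hχ => card_embeddings_of_coloring χ p (F.not_isDiag_of_mem_edgeSet he.1) hχ hxy hx hy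
  rw [sum_congr rfl fun e he => sum_congr rfl fun χ hχ =>
    (h3 e (mem_filter.1 he).2 χ (mem_filter.1 hχ).2).symm]
  simp_rw [← card_sigma]
  symm
  -- The embedding recovers the other data: `χ` is the part map along it, and `e` is its only edge
  -- inside a part. That edge is critical because `χ` colors `F - e`.
  refine card_bij (fun z _ => z.2.2) ?_ ?_ ?_
  · rintro ⟨e, χ, φ⟩ h
    simp only [mem_sigma, mem_filter, mem_univ, true_and] at h
    obtain ⟨he, hχ, hφ, hφχ⟩ := h
    simp only [singleMono, mem_filter, mem_univ, true_and]
    refine ⟨e, ?_, hφ⟩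
    ext e'
    simp only [mem_monoEdges, mem_singleton, hφχ]
    constructor
    · rintro ⟨h1, h2⟩
      by_contra hne
      induction e' with
      | _ a b =>
      exact χ.valid (deleteEdges_adj.2 ⟨h1, by simpa using hne⟩) h2
    · rintro rfl
      refine ⟨he.1, ?_⟩
      induction e' with
      | _ a b =>
      change χ a = χ b
      rw [hχ a (by simp), hχ b (by simp)]
  · rintro ⟨e, χ, φ⟩ h ⟨e', χ', φ'⟩ h' heq
    simp only at heq
    subst heq
    simp only [mem_sigma, mem_filter, mem_univ, true_and] at h h'
    have h4 : Sym2.map φ e = Sym2.map φ e' := h.2.2.1.trans h'.2.2.1.symm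
    have h5 : e = e' := Sym2.map.injective φ.injective h4
    subst h5
    have h6 : χ = χ' := by
      ext w
      rw [← h.2.2.2 w, ← h'.2.2.2 w]
    subst h6
    rfl
  · intro φ hφ
    simp only [singleMono, mem_filter, mem_univ, true_and] at hφ
    obtain ⟨e, he, heb⟩ := hφ
    have heF : e ∈ F.edgeSet := by
      have : e ∈ monoEdges F p φ := by simp [he]
      exact (mem_monoEdges.1 this).1
    let χ : (F.deleteEdges {e}).Coloring (Fin r) := Coloring.mk (fun w => p (φ w)) (by
      intro a b hab heq
      rw [deleteEdges_adj] at hab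
      have : s(a, b) ∈ monoEdges F p φ := mem_monoEdges.2 ⟨hab.1, heq⟩
      rw [he, mem_singleton] at this
      exact hab.2 (by simp [this]))
    refine ⟨⟨e, χ, φ⟩, ?_, rfl⟩
    simp only [mem_sigma, mem_filter, mem_univ, true_and]
    refine ⟨isCriticalEdge_of_colorable hF heF ⟨χ⟩, fun w hw => ?_, heb, fun w => rfl⟩
    apply hp
    rw [← heb]
    exact Sym2.mem_map.2 ⟨w, hw, rfl⟩

/-- Copies of `F` in `G`, as embeddings of the vertex set. -/
noncomputable def copyEmbeddings {V W : Type*} [Fintype V] [Fintype W] (F : SimpleGraph V)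
    (G : SimpleGraph W) : Finset (V ↪ W) :=
  {φ | ∀ a b, F.Adj a b → G.Adj (φ a) (φ b)}

lemma mem_copyEmbeddings {V W : Type*} [Fintype V] [Fintype W] {F : SimpleGraph V}
    {G : SimpleGraph W} {φ : V ↪ W} :
    φ ∈ copyEmbeddings F G ↔ ∀ a b, F.Adj a b → G.Adj (φ a) (φ b) := by
  simp [copyEmbeddings]

lemma card_copyEmbeddings {V W : Type*} [Fintype V] [Fintype W] (F : SimpleGraph V)
    (G : SimpleGraph W) :
    #(copyEmbeddings F G) = Nat.card (F ≃g F) * G.copyCount F := by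
  rw [← labelledCopyCount_eq, labelledCopyCount, ← Finset.card_univ]
  symm
  refine card_bij (fun f _ => f.toEmbedding) (fun f _ => ?_) (fun f _ g _ h => ?_) fun φ hφ => ?_
  · exact mem_filter.2 ⟨mem_univ _, fun a b hab => f.toHom.map_adj hab⟩
  · ext v
    exact DFunLike.congr_fun h v
  · exact ⟨⟨⟨φ, fun {a b} hab => (mem_filter.1 hφ).2 a b hab⟩, φ.injective⟩, mem_univ _, rfl⟩

lemma card_aut_pos {V : Type*} [Fintype V] (F : SimpleGraph V) : 0 < Nat.card (F ≃g F) := by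
  have : Finite (F ≃g F) :=
    Finite.of_injective (fun σ : F ≃g F => (σ : V → V)) DFunLike.coe_injective
  have : Nonempty (F ≃g F) := ⟨Iso.refl⟩
  exact Nat.card_pos

/-! ### Lower bound: copies forced by edges inside parts. -/

/-- The edges of `G` inside parts. -/
noncomputable def innerEdges {W ι : Type*} [Fintype W] (G : SimpleGraph W) (p : W → ι) :
    Finset (Sym2 W) :=
  {b | b ∈ G.edgeSet ∧ (b.map p).IsDiag}

lemma mem_innerEdges {W ι : Type*} [Fintype W] {G : SimpleGraph W} {p : W → ι} {b : Sym2 W} :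
    b ∈ innerEdges G p ↔ b ∈ G.edgeSet ∧ (b.map p).IsDiag := by
  simp [innerEdges]

lemma card_innerEdges {W ι : Type*} [Fintype W] {G : SimpleGraph W} {p : W → ι}
    (h : multipartite p ≤ G) :
    #(innerEdges G p) + #(multipartite p).edgeFinset = #G.edgeFinset := by
  rw [← card_union_of_disjoint]
  · congr 1
    ext b
    rw [mem_union, mem_innerEdges, mem_edgeFinset, mem_edgeFinset]
    induction b with
    | _ x y =>
    have : (multipartite p).Adj x y → G.Adj x y := fun hxy => h hxy
    simp only [mem_edgeSet, Sym2.map_mk, Sym2.mk_isDiag_iff, multipartite_adj] at this ⊢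
    tauto
  · rw [Finset.disjoint_left]
    intro b hb hb'
    rw [mem_innerEdges] at hb
    rw [mem_edgeFinset] at hb'
    induction b with
    | _ x y =>
    exact hb' hb.2

/-- Lets any part be renamed to the first one, the only one for which c is defined. -/
lemma monoEdges_comp_perm {V W ι : Type*} [Fintype V] (F : SimpleGraph V) (p : W → ι)
    (σ : Equiv.Perm ι) (φ : V ↪ W) : monoEdges F (fun x => σ (p x)) φ = monoEdges F p φ := by
  ext e
  rw [mem_monoEdges, mem_monoEdges]
  induction e with
  | _ a b => simp

/-- The number of copies of `F` that use exactly the edge `b` inside the part `a`. -/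
lemma card_singleMono_part {V W : Type*} [Fintype V] [Fintype W] {F : SimpleGraph V} {r : ℕ}
    [r.AtLeastTwo] (hF : ¬ F.Colorable r) (p : W → Fin r) {b : Sym2 W} (hb : ¬ b.IsDiag)
    (a : Fin r) (hp : ∀ x ∈ b, p x = a) :
    (#(singleMono F p b) : ℝ) = (Nat.card (F ≃g F) : ℝ) *
      MvPolynomial.eval (fun i => (partSize p (Equiv.swap 0 a i) : ℝ)) (cPoly F r) := by
  have h := card_singleMono hF (fun x => Equiv.swap 0 a (p x)) hb
    (fun x hx => by rw [hp x hx, Equiv.swap_apply_right])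
  simp only [singleMono, monoEdges_comp_perm] at h
  rw [singleMono, h]
  congr! 4 with i
  simp only [partSize]
  congr 2
  ext x
  simp only [mem_filter, mem_univ, true_and]
  rw [← Equiv.eq_symm_apply, Equiv.symm_swap]

/-- Otherwise the parts would induce a proper `r`-coloring of `F`. -/
lemma monoEdges_nonempty {V W : Type*} [Fintype V] {F : SimpleGraph V} {r : ℕ}
    (hF : ¬ F.Colorable r) (p : W → Fin r) (φ : V ↪ W) : (monoEdges F p φ).Nonempty := by
  by_contra h
  rw [not_nonempty_iff_eq_empty] at h
  refine hF ⟨Coloring.mk (fun w => p (φ w)) fun {a b} hab heq => ?_⟩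
  have : s(a, b) ∈ monoEdges F p φ := mem_monoEdges.2 ⟨hab, heq⟩
  simp [h] at this

lemma singleMono_pairwiseDisjoint {V W ι : Type*} [Fintype V] [Fintype W] (F : SimpleGraph V)
    (p : W → ι) (s : Set (Sym2 W)) : s.PairwiseDisjoint (singleMono F p) := by
  intro b _ b' _ hbb'
  rw [Function.onFun, Finset.disjoint_left]
  intro φ h h'
  obtain ⟨e, he, hb⟩ := (mem_filter.1 h).2
  obtain ⟨e', he', hb'⟩ := (mem_filter.1 h').2
  rw [he, singleton_inj] at he'
  subst he'
  exact hbb' (hb.symm.trans hb')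

/-- Every edge inside a part of a complete multipartite graph creates many copies of `F`. -/
lemma mul_le_copyCount {V W : Type*} [Fintype V] [Fintype W] {F : SimpleGraph V} {r : ℕ}
    [r.AtLeastTwo] (hF : ¬ F.Colorable r) (p : W → Fin r) {G : SimpleGraph W}
    (hG : multipartite p ≤ G) (m : ℝ)
    (hm : ∀ a, m ≤ MvPolynomial.eval (fun i => (partSize p (Equiv.swap 0 a i) : ℝ)) (cPoly F r)) :
    ((#G.edgeFinset : ℝ) - #(multipartite p).edgeFinset) * m ≤ G.copyCount F := by
  have hA : (0 : ℝ) < Nat.card (F ≃g F) := by exact_mod_cast card_aut_pos F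
  -- Only copies with exactly one inner edge are counted, so those of different edges are disjoint
  -- and their numbers add up.
  have h1 : (innerEdges G p).biUnion (singleMono F p) ⊆ copyEmbeddings F G := by
    intro φ hφ
    obtain ⟨b, hb, hφ⟩ := mem_biUnion.1 hφ
    obtain ⟨e, he, heb⟩ := (mem_filter.1 hφ).2
    refine mem_filter.2 ⟨mem_univ _, fun x y hxy => ?_⟩
    by_cases hd : p (φ x) = p (φ y)
    · have : s(x, y) ∈ monoEdges F p φ := mem_monoEdges.2 ⟨hxy, hd⟩
      rw [he, mem_singleton] at this
      rw [← this] at heb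
      rw [← mem_edgeSet]
      have h2 := (mem_innerEdges.1 hb).1
      rwa [← heb] at h2
    · exact hG hd
  have h2 := card_le_card h1
  rw [card_biUnion (singleMono_pairwiseDisjoint F p _), card_copyEmbeddings] at h2
  have h3 : ∀ b ∈ innerEdges G p, (Nat.card (F ≃g F) : ℝ) * m ≤ #(singleMono F p b) := by
    intro b hb
    rw [mem_innerEdges] at hb
    have hd := G.not_isDiag_of_mem_edgeSet hb.1
    induction b with
    | _ x y =>
    rw [card_singleMono_part hF p hd (p x) (by
      intro z hz
      rcases Sym2.mem_iff.1 hz with rfl | rfl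
      · rfl
      · exact hb.2.symm)]
    exact mul_le_mul_of_nonneg_left (hm _) hA.le
  have h4 : (#(innerEdges G p) : ℝ) * (Nat.card (F ≃g F) * m) ≤
      Nat.card (F ≃g F) * G.copyCount F := by
    rw [← nsmul_eq_mul]
    refine (card_nsmul_le_sum _ _ _ h3).trans ?_
    exact_mod_cast h2
  have h5 : (#G.edgeFinset : ℝ) - #(multipartite p).edgeFinset = #(innerEdges G p) := by
    rw [← card_innerEdges hG]
    push_cast
    ring
  rw [h5]
  refine le_of_mul_le_mul_left ?_ hA
  linarith

/-! ### Upper bound: pair-freeness and triangle-free inner graphs. -/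

/-- Three edges not forming a triangle form a forest. -/
lemma exists_forest {V : Type*} (S : Finset (Sym2 V)) (hS : 3 ≤ #S)
    (hdiag : ∀ e ∈ S, ¬ e.IsDiag)
    (htri : ∀ a b c, s(a, b) ∈ S → s(b, c) ∈ S → s(a, c) ∈ S → False) :
    ∃ u₁ v₁ u₂ v₂ u₃ v₃, s(u₁, v₁) ∈ S ∧ s(u₂, v₂) ∈ S ∧ s(u₃, v₃) ∈ S ∧ v₁ ≠ u₁ ∧
      v₂ ≠ u₂ ∧ v₂ ≠ u₁ ∧ v₂ ≠ v₁ ∧ v₃ ≠ u₃ ∧ v₃ ≠ u₁ ∧ v₃ ≠ v₁ ∧ v₃ ≠ u₂ ∧ v₃ ≠ v₂ := by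
  -- Of two distinct edges the second has an end outside the first; a third edge with an end outside
  -- both completes an ordering in which every edge brings a new vertex `vᵢ`.
  have second : ∀ e ∈ S, ∀ e' ∈ S, e ≠ e' → ∀ u₃ v₃, s(u₃, v₃) ∈ S → v₃ ≠ u₃ → v₃ ∉ e →
      v₃ ∉ e' → ∃ u₁ v₁ u₂ v₂ u₃ v₃, s(u₁, v₁) ∈ S ∧ s(u₂, v₂) ∈ S ∧ s(u₃, v₃) ∈ S ∧ v₁ ≠ u₁ ∧
      v₂ ≠ u₂ ∧ v₂ ≠ u₁ ∧ v₂ ≠ v₁ ∧ v₃ ≠ u₃ ∧ v₃ ≠ u₁ ∧ v₃ ≠ v₁ ∧ v₃ ≠ u₂ ∧ v₃ ≠ v₂ := by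
    intro e he e' he' hee' u₃ v₃ h3 h3' hv hv'
    have hd := hdiag e he
    have hd' := hdiag e' he'
    induction e with
    | _ a b =>
    induction e' with
    | _ c d =>
    simp only [Sym2.mem_iff, not_or, Sym2.mk_isDiag_iff] at hv hv' hd hd'
    by_cases hc : c = a ∨ c = b
    · have : d ≠ a ∧ d ≠ b := by
        constructor <;> rintro rfl <;> rcases hc with rfl | rfl <;> simp_all [Sym2.eq_swap]
      exact ⟨a, b, c, d, u₃, v₃, he, he', h3, Ne.symm hd, Ne.symm hd', this.1, this.2, h3',
        hv.1, hv.2, hv'.1, hv'.2⟩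
    · push Not at hc
      exact ⟨a, b, d, c, u₃, v₃, he, Sym2.eq_swap ▸ he', h3, Ne.symm hd, hd', hc.1, hc.2, h3',
        hv.1, hv.2, hv'.2, hv'.1⟩
  obtain ⟨e₁, h1, e₂, h2, e₃, h3, h12, h13, h23⟩ := two_lt_card.1 hS
  by_contra hcon
  have leaf : ∀ e ∈ S, ∀ e' ∈ S, ∀ e'' ∈ S, e ≠ e' → ∀ x ∈ e'', x ∈ e ∨ x ∈ e' := by
    intro e he e' he' e'' he'' hee' x hx
    by_contra! h
    obtain ⟨y, rfl⟩ := Sym2.mem_iff_exists.1 hx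
    exact hcon (second e he e' he' hee' y x (Sym2.eq_swap ▸ he'')
      (by simpa using hdiag _ he'') h.1 h.2)
  have l1 := leaf e₂ h2 e₃ h3 e₁ h1 h23
  have l2 := leaf e₁ h1 e₃ h3 e₂ h2 h13
  have d1 := hdiag _ h1
  have d2 := hdiag _ h2
  induction e₁ with
  | _ a b =>
  -- Without a forest every end of an edge lies on one of any two distinct edges. This forces the
  -- far ends of `e₂` and `e₃` to coincide, giving a triangle.
  have key : ∀ a b, s(a, b) ∈ S → a ≠ b → s(a, b) ≠ e₂ → s(a, b) ≠ e₃ → a ∈ e₂ → b ∈ e₃ →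
      (∀ x ∈ e₂, x ∈ s(a, b) ∨ x ∈ e₃) → False := by
    intro a b hab hne hn2 hn3 ha hb hl
    obtain ⟨c, rfl⟩ := Sym2.mem_iff_exists.1 ha
    obtain ⟨d, rfl⟩ := Sym2.mem_iff_exists.1 hb
    simp only [Sym2.mk_isDiag_iff] at d2
    have hcb : c ≠ b := fun h => hn2 (by rw [h])
    have hcd : c = d := by
      have := hl c (by simp)
      simp only [Sym2.mem_iff] at this
      rcases this with (h | h) | h | h
      · exact absurd h.symm d2
      · exact absurd h hcb
      · exact absurd h hcb
      · exact h
    subst hcd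
    exact htri a b c hab h3 h2
  have ha := l1 a (by simp)
  have hb := l1 b (by simp)
  have hne : a ≠ b := d1
  have both : ∀ e, a ∈ e → b ∈ e → s(a, b) = e := fun e ha hb =>
    ((Sym2.mem_and_mem_iff hne).1 ⟨ha, hb⟩).symm
  rcases ha with ha | ha
  · rcases hb with hb | hb
    · exact h12 (both _ ha hb)
    · exact key a b h1 hne h12 h13 ha hb l2
  · rcases hb with hb | hb
    · refine key b a (Sym2.eq_swap ▸ h1) hne.symm (Sym2.eq_swap ▸ h12) (Sym2.eq_swap ▸ h13) hb ha ?_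
      rwa [Sym2.eq_swap]
    · exact h13 (both _ ha hb)

/-- A family of embeddings in which three vertices are determined, up to a label, by others. -/
lemma card_le_of_three_determined {V W : Type*} [Fintype V] [Fintype W] {D : ℕ} (blk : W → ℕ)
    (lab : W → Fin D) (P : W → Prop)
    (hinj : ∀ x y, P x → P y → blk x = blk y → lab x = lab y → x = y)
    {u₁ v₁ u₂ v₂ u₃ v₃ : V} (h1 : v₁ ≠ u₁) (h2 : v₂ ≠ u₂) (h3 : v₂ ≠ u₁) (h4 : v₂ ≠ v₁)
    (h5 : v₃ ≠ u₃) (h6 : v₃ ≠ u₁) (h7 : v₃ ≠ v₁) (h8 : v₃ ≠ u₂) (h9 : v₃ ≠ v₂) :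
    #{φ : V ↪ W | (P (φ v₁) ∧ blk (φ v₁) = blk (φ u₁)) ∧ (P (φ v₂) ∧ blk (φ v₂) = blk (φ u₂)) ∧
      P (φ v₃) ∧ blk (φ v₃) = blk (φ u₃)} ≤
      D ^ 3 * Fintype.card W ^ (Fintype.card V - 3) := by
  have hcard : D ^ 3 * Fintype.card W ^ (Fintype.card V - 3) =
      Fintype.card ((Fin D × Fin D × Fin D) × ({w // w ∉ ({v₁, v₂, v₃} : Finset V)} → W)) := by
    have : #({v₁, v₂, v₃} : Finset V) = 3 := card_eq_three.2 ⟨_, _, _, h4.symm, h7.symm, h9.symm, rfl⟩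
    rw [Fintype.card_prod, Fintype.card_fun, Fintype.card_prod, Fintype.card_prod,
      Fintype.card_fin, Fintype.card_subtype_compl, Fintype.card_coe, this]
    ring
  rw [hcard, ← Finset.card_univ]
  -- The three vertices are decoded in order: `uᵢ` is known before `vᵢ`, so its block and the stored
  -- label determine the image of `vᵢ`.
  refine card_le_card_of_injOn
    (fun φ => ((lab (φ v₁), lab (φ v₂), lab (φ v₃)), fun w => φ w)) (by simp) ?_
  intro φ hφ ψ hψ heq
  simp only [coe_filter, mem_univ, true_and, Set.mem_ofPred_eq] at hφ hψ
  simp only [Prod.mk.injEq] at heq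
  obtain ⟨⟨l1, l2, l3⟩, hrest⟩ := heq
  have hr : ∀ w, w ≠ v₁ → w ≠ v₂ → w ≠ v₃ → φ w = ψ w := fun w a b c =>
    congrFun hrest ⟨w, by simp [a, b, c]⟩
  have e1 : φ v₁ = ψ v₁ := by
    refine hinj _ _ hφ.1.1 hψ.1.1 ?_ l1
    rw [hφ.1.2, hψ.1.2, hr u₁ h1.symm h3.symm h6.symm]
  have hr' : ∀ w, w ≠ v₂ → w ≠ v₃ → φ w = ψ w := by
    intro w a b
    by_cases hw : w = v₁
    · rw [hw, e1]
    · exact hr w hw a b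
  have e2 : φ v₂ = ψ v₂ := by
    refine hinj _ _ hφ.2.1.1 hψ.2.1.1 ?_ l2
    rw [hφ.2.1.2, hψ.2.1.2, hr' u₂ h2.symm h8.symm]
  have hr'' : ∀ w, w ≠ v₃ → φ w = ψ w := by
    intro w a
    by_cases hw : w = v₂
    · rw [hw, e2]
    · exact hr' w hw a
  have e3 : φ v₃ = ψ v₃ := by
    refine hinj _ _ hφ.2.2.1 hψ.2.2.1 ?_ l3
    rw [hφ.2.2.2, hψ.2.2.2, hr'' u₃ h5.symm]
  ext w
  by_cases hw : w = v₃
  · rw [hw, e3]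
  · exact hr'' w hw

/-- A triangle-free graph inside the first part, with components in blocks of size `D`. -/
structure IsBlockGraph {W : Type*} {r : ℕ} [NeZero r] (p : W → Fin r) (D : ℕ) (B : SimpleGraph W)
    (blk : W → ℕ) (lab : W → Fin D) : Prop where
  left_part : ∀ x y, B.Adj x y → p x = 0
  blk_eq : ∀ x y, B.Adj x y → blk x = blk y
  inj : ∀ x y, p x = 0 → p y = 0 → blk x = blk y → lab x = lab y → x = y
  triangleFree : ∀ x y z, B.Adj x y → B.Adj y z → B.Adj x z → False

/-- For pair-free `F`, there are few copies of `F` using more than one edge of a triangle-free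
graph of bounded degree placed in the first part. -/
lemma card_multiple_mono_le {V W : Type*} [Fintype V] [Fintype W] {F : SimpleGraph V} {r : ℕ}
    [r.AtLeastTwo] (hpf : IsPairFree F r) (p : W → Fin r) {D : ℕ} {B : SimpleGraph W}
    {blk : W → ℕ} {lab : W → Fin D} (hB : IsBlockGraph p D B blk lab) :
    #{φ ∈ copyEmbeddings F (multipartite p ⊔ B) | 1 < #(monoEdges F p φ)} ≤
      Fintype.card V ^ 6 * (D ^ 3 * Fintype.card W ^ (Fintype.card V - 3)) := by
  let good : Finset (V × V × V × V × V × V) :=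
    {τ | τ.2.1 ≠ τ.1 ∧ τ.2.2.2.1 ≠ τ.2.2.1 ∧ τ.2.2.2.1 ≠ τ.1 ∧ τ.2.2.2.1 ≠ τ.2.1 ∧
      τ.2.2.2.2.2 ≠ τ.2.2.2.2.1 ∧ τ.2.2.2.2.2 ≠ τ.1 ∧ τ.2.2.2.2.2 ≠ τ.2.1 ∧
      τ.2.2.2.2.2 ≠ τ.2.2.1 ∧ τ.2.2.2.2.2 ≠ τ.2.2.2.1}
  let T : V × V × V × V × V × V → Finset (V ↪ W) := fun τ =>
    {φ : V ↪ W | (p (φ τ.2.1) = 0 ∧ blk (φ τ.2.1) = blk (φ τ.1)) ∧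
      (p (φ τ.2.2.2.1) = 0 ∧ blk (φ τ.2.2.2.1) = blk (φ τ.2.2.1)) ∧
      p (φ τ.2.2.2.2.2) = 0 ∧ blk (φ τ.2.2.2.2.2) = blk (φ τ.2.2.2.2.1)}
  have hsub : {φ ∈ copyEmbeddings F (multipartite p ⊔ B) | 1 < #(monoEdges F p φ)} ⊆
      good.biUnion T := by
    intro φ hφ
    obtain ⟨hφ, hcard⟩ := mem_filter.1 hφ
    have hφ := mem_copyEmbeddings.1 hφ
    have hadj : ∀ a b, s(a, b) ∈ monoEdges F p φ → B.Adj (φ a) (φ b) := by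
      intro a b hab
      obtain ⟨h1, h2⟩ := mem_monoEdges.1 hab
      rcases hφ a b h1 with h | h
      · exact absurd h2 h
      · exact h
    have hzero : ∀ e ∈ monoEdges F p φ, ∀ w ∈ e, p (φ w) = 0 := by
      intro e he w hw
      obtain ⟨z, rfl⟩ := Sym2.mem_iff_exists.1 hw
      exact hB.left_part _ _ (hadj _ _ he)
    -- All inner edges lie in part 0, so exactly two of them would be a pair forbidden by
    -- pair-freeness.
    have hthree : 3 ≤ #(monoEdges F p φ) := by
      by_contra! hlt
      obtain ⟨e₁, e₂, hne, he⟩ := card_eq_two.1 (by omega : #(monoEdges F p φ) = 2)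
      have m1 : e₁ ∈ monoEdges F p φ := by simp [he]
      have m2 : e₂ ∈ monoEdges F p φ := by simp [he]
      refine hpf.2 ⟨e₁, (mem_monoEdges.1 m1).1, e₂, (mem_monoEdges.1 m2).1, hne,
        Coloring.mk (fun w => p (φ w)) ?_, 0, ?_⟩
      · intro a b hab heq
        rw [deleteEdges_adj] at hab
        have : s(a, b) ∈ monoEdges F p φ := mem_monoEdges.2 ⟨hab.1, heq⟩
        rw [he, mem_insert, mem_singleton] at this
        exact hab.2 this
      · rintro w (hw | hw)
        · exact hzero _ m1 w hw
        · exact hzero _ m2 w hw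
    obtain ⟨u₁, v₁, u₂, v₂, u₃, v₃, m1, m2, m3, hd⟩ := exists_forest (monoEdges F p φ) hthree
      (fun e he => F.not_isDiag_of_mem_edgeSet (mem_monoEdges.1 he).1)
      (fun a b c hab hbc hac => hB.triangleFree _ _ _ (hadj _ _ hab) (hadj _ _ hbc) (hadj _ _ hac))
    refine mem_biUnion.2 ⟨(u₁, v₁, u₂, v₂, u₃, v₃), mem_filter.2 ⟨mem_univ _, hd⟩,
      mem_filter.2 ⟨mem_univ _, ?_⟩⟩
    exact ⟨⟨hzero _ m1 _ (by simp), (hB.blk_eq _ _ (hadj _ _ m1)).symm⟩,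
      ⟨hzero _ m2 _ (by simp), (hB.blk_eq _ _ (hadj _ _ m2)).symm⟩,
      hzero _ m3 _ (by simp), (hB.blk_eq _ _ (hadj _ _ m3)).symm⟩
  refine (card_le_card hsub).trans ((card_biUnion_le_card_mul _ _
    (D ^ 3 * Fintype.card W ^ (Fintype.card V - 3)) ?_).trans ?_)
  · rintro ⟨u₁, v₁, u₂, v₂, u₃, v₃⟩ hτ
    obtain ⟨h1, h2, h3, h4, h5, h6, h7, h8, h9⟩ := (mem_filter.1 hτ).2
    convert! card_le_of_three_determined blk lab (fun x => p x = 0) hB.inj h1 h2 h3 h4 h5 h6 h7 h8 h9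
  · gcongr
    refine (card_le_univ _).trans (le_of_eq ?_)
    simp only [Fintype.card_prod]
    ring

/-- Upper bound on the number of copies of a pair-free graph. -/
lemma copyCount_le {V W : Type*} [Fintype V] [Fintype W] {F : SimpleGraph V} {r : ℕ}
    [r.AtLeastTwo] (hF : ¬ F.Colorable r) (hpf : IsPairFree F r) (p : W → Fin r) {D : ℕ}
    {B : SimpleGraph W} {blk : W → ℕ} {lab : W → Fin D} (hB : IsBlockGraph p D B blk lab) :
    ((multipartite p ⊔ B).copyCount F : ℝ) ≤
      #B.edgeFinset * MvPolynomial.eval (fun i => (partSize p i : ℝ)) (cPoly F r) +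
        (Fintype.card V ^ 6 * D ^ 3 : ℕ) * (Fintype.card W : ℝ) ^ (Fintype.card V - 3) := by
  have hA : (1 : ℝ) ≤ Nat.card (F ≃g F) := by exact_mod_cast card_aut_pos F
  -- Each copy has at least one inner edge. Those with exactly one give the main term, the others
  -- the error.
  have h1 : copyEmbeddings F (multipartite p ⊔ B) ⊆ B.edgeFinset.biUnion (singleMono F p) ∪
      {φ ∈ copyEmbeddings F (multipartite p ⊔ B) | 1 < #(monoEdges F p φ)} := by
    intro φ hφ
    by_cases h : 1 < #(monoEdges F p φ)
    · exact mem_union_right _ (mem_filter.2 ⟨hφ, h⟩)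
    · have := (monoEdges_nonempty hF p φ).card_pos
      obtain ⟨e, he⟩ := card_eq_one.1 (by omega : #(monoEdges F p φ) = 1)
      refine mem_union_left _ (mem_biUnion.2 ⟨e.map φ, ?_, mem_filter.2 ⟨mem_univ _, e, he, rfl⟩⟩)
      have hm : e ∈ monoEdges F p φ := by simp [he]
      rw [mem_edgeFinset]
      induction e with
      | _ a b =>
      obtain ⟨h2, h3⟩ := mem_monoEdges.1 hm
      rcases mem_copyEmbeddings.1 hφ a b h2 with h | h
      · exact absurd h3 h
      · exact h
  have h2 := (card_le_card h1).trans ((card_union_le _ _).trans (add_le_add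
    card_biUnion_le (card_multiple_mono_le hpf p hB)))
  rw [card_copyEmbeddings] at h2
  have h3 : ∀ b ∈ B.edgeFinset, (#(singleMono F p b) : ℝ) = (Nat.card (F ≃g F) : ℝ) *
      MvPolynomial.eval (fun i => (partSize p i : ℝ)) (cPoly F r) := by
    intro b hb
    rw [mem_edgeFinset] at hb
    refine card_singleMono hF p (B.not_isDiag_of_mem_edgeSet hb) fun x hx => ?_
    obtain ⟨z, rfl⟩ := Sym2.mem_iff_exists.1 hx
    exact hB.left_part _ _ hb
  have h4 : (Nat.card (F ≃g F) : ℝ) * ((multipartite p ⊔ B).copyCount F : ℝ) ≤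
      #B.edgeFinset * ((Nat.card (F ≃g F) : ℝ) *
        MvPolynomial.eval (fun i => (partSize p i : ℝ)) (cPoly F r)) +
        (Fintype.card V ^ 6 * D ^ 3 : ℕ) * (Fintype.card W : ℝ) ^ (Fintype.card V - 3) := by
    rw [← nsmul_eq_mul (#B.edgeFinset), ← sum_const, ← sum_congr rfl h3]
    have h5 : ((Nat.card (F ≃g F) * (multipartite p ⊔ B).copyCount F : ℕ) : ℝ) ≤ _ :=
      Nat.cast_le.2 h2
    push_cast at h5 ⊢
    linarith
  have h5 : (0 : ℝ) ≤ (Fintype.card V ^ 6 * D ^ 3 : ℕ) *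
      (Fintype.card W : ℝ) ^ (Fintype.card V - 3) := by positivity
  -- Dividing by the number of automorphisms, at least 1, can only shrink the error term.
  refine le_of_mul_le_mul_left (h4.trans ?_) (by linarith : (0 : ℝ) < Nat.card (F ≃g F))
  rw [mul_add]
  nlinarith

/-! ### Orders of growth and the first order expansion of c. -/

open Asymptotics

/-- `u n = O(n ^ k)`. -/
def PowBound (u : ℕ → ℝ) (k : ℤ) : Prop := u =O[atTop] fun n : ℕ => (n : ℝ) ^ k

lemma PowBound.mono {u : ℕ → ℝ} {k l : ℤ} (h : PowBound u k) (hkl : k ≤ l) : PowBound u l := by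
  refine h.trans (IsBigO.of_bound 1 ?_)
  filter_upwards [eventually_ge_atTop 1] with n hn
  have hn' : (1 : ℝ) ≤ n := by exact_mod_cast hn
  rw [one_mul, Real.norm_of_nonneg (by positivity), Real.norm_of_nonneg (by positivity)]
  exact zpow_le_zpow_right₀ hn' hkl

lemma PowBound.mul {u v : ℕ → ℝ} {k l m : ℤ} (h : PowBound u k) (h' : PowBound v l)
    (hm : k + l = m) : PowBound (fun n => u n * v n) m := by
  refine (IsBigO.mul h h').congr' (Eventually.of_forall fun _ => rfl) ?_
  filter_upwards [eventually_ge_atTop 1] with n hn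
  have hn' : (n : ℝ) ≠ 0 := by exact_mod_cast (by omega : n ≠ 0)
  rw [← hm, zpow_add₀ hn']

lemma PowBound.add {u v : ℕ → ℝ} {k : ℤ} (h : PowBound u k) (h' : PowBound v k) :
    PowBound (fun n => u n + v n) k := IsBigO.add h h'

lemma PowBound.sub {u v : ℕ → ℝ} {k : ℤ} (h : PowBound u k) (h' : PowBound v k) :
    PowBound (fun n => u n - v n) k := IsBigO.sub h h'

lemma PowBound.congr {u v : ℕ → ℝ} {k : ℤ} (h : PowBound u k) (huv : ∀ n, v n = u n) :
    PowBound v k := by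
  rwa [show v = u from funext huv]

lemma powBound_zero (k : ℤ) : PowBound (fun _ => 0) k := isBigO_zero _ _

lemma PowBound.of_abs_le {u : ℕ → ℝ} (K : ℝ) (h : ∀ n, |u n| ≤ K) : PowBound u 0 :=
  IsBigO.of_bound K (Eventually.of_forall fun n => by simpa using h n)

lemma powBound_const (c : ℝ) : PowBound (fun _ => c) 0 := PowBound.of_abs_le |c| fun _ => le_rfl

lemma powBound_natCast : PowBound (fun n => (n : ℝ)) 1 :=
  (isBigO_refl _ _).congr' (Eventually.of_forall fun _ => rfl) (Eventually.of_forall fun n => by simp)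

lemma powBound_pow (d : ℕ) : PowBound (fun n => (n : ℝ) ^ d) d :=
  (isBigO_refl _ _).congr' (Eventually.of_forall fun _ => rfl) (Eventually.of_forall fun n => by simp)

lemma PowBound.sum {ι : Type*} {s : Finset ι} {u : ι → ℕ → ℝ} {k : ℤ}
    (h : ∀ i ∈ s, PowBound (u i) k) : PowBound (fun n => ∑ i ∈ s, u i n) k := by
  induction s using Finset.induction_on with
  | empty => simpa using powBound_zero k
  | insert a s ha ih =>
    refine ((h a (by simp)).add (ih fun i hi => h i (by simp [hi]))).congr fun n => ?_
    rw [sum_insert ha]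

lemma powBound_eval_sub_leading (q : Polynomial ℝ) {d : ℕ} (hq : q.natDegree ≤ d) :
    PowBound (fun n => q.eval (n : ℝ) - q.coeff d * (n : ℝ) ^ d) ((d : ℤ) - 1) := by
  have h : ∀ n : ℕ, q.eval (n : ℝ) - q.coeff d * (n : ℝ) ^ d =
      ∑ i ∈ range d, q.coeff i * (n : ℝ) ^ i := by
    intro n
    rw [Polynomial.eval_eq_sum_range' (Nat.lt_succ_of_le hq), sum_range_succ]
    ring
  refine PowBound.congr ?_ h
  refine PowBound.sum fun i hi => ?_
  exact ((powBound_const _).mul (powBound_pow i) (zero_add _)).mono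
    (by have := mem_range.1 hi; omega)

/-- First order expansion of `P` around `x` with increments `δ`, when `P` has degree `d`, `x` grows
linearly and `δ` is bounded; and degree bounds for the substitution `balanced`. -/
structure HasExpansion {r : ℕ} (x δ : ℕ → Fin r → ℝ) (d : ℕ) (P : MvPolynomial (Fin r) ℝ) :
    Prop where
  value : PowBound (fun n => MvPolynomial.eval (x n) P) d
  deriv : PowBound (fun n => ∑ i, δ n i * MvPolynomial.eval (x n) (MvPolynomial.pderiv i P))
    ((d : ℤ) - 1)
  rest : PowBound (fun n => MvPolynomial.eval (x n + δ n) P - MvPolynomial.eval (x n) P -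
    ∑ i, δ n i * MvPolynomial.eval (x n) (MvPolynomial.pderiv i P)) ((d : ℤ) - 2)
  degree_le : (balanced r P).degree ≤ d
  degree_lt : ∀ i, (balanced r (MvPolynomial.pderiv i P)).degree < d

lemma balanced_mul {r : ℕ} (P Q : MvPolynomial (Fin r) ℝ) :
    balanced r (P * Q) = balanced r P * balanced r Q := map_mul _ _ _

lemma balanced_add {r : ℕ} (P Q : MvPolynomial (Fin r) ℝ) :
    balanced r (P + Q) = balanced r P + balanced r Q := map_add _ _ _

lemma hasExpansion_C {r : ℕ} (x δ : ℕ → Fin r → ℝ) (c : ℝ) :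
    HasExpansion x δ 0 (MvPolynomial.C c) where
  value := by simpa using powBound_const c
  deriv := by simpa using powBound_zero _
  rest := by simpa using powBound_zero _
  degree_le := by
    have : balanced r (MvPolynomial.C c) = Polynomial.C c := by simp [balanced]
    rw [this]
    exact Polynomial.degree_C_le
  degree_lt i := by simp [balanced]

lemma HasExpansion.mono {r : ℕ} {x δ : ℕ → Fin r → ℝ} {d d' : ℕ} {P : MvPolynomial (Fin r) ℝ}
    (h : HasExpansion x δ d P) (hd : d ≤ d') : HasExpansion x δ d' P where
  value := h.value.mono (by omega)
  deriv := h.deriv.mono (by omega)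
  rest := h.rest.mono (by omega)
  degree_le := h.degree_le.trans (by exact_mod_cast hd)
  degree_lt i := (h.degree_lt i).trans_le (by exact_mod_cast hd)

lemma hasExpansion_X {r : ℕ} {x δ : ℕ → Fin r → ℝ} (hx : ∀ i, PowBound (fun n => x n i) 1)
    (hδ : ∀ i, PowBound (fun n => δ n i) 0) (j : Fin r) :
    HasExpansion x δ 1 (MvPolynomial.X j) := by
  have h1 : ∀ n, ∑ i, δ n i * MvPolynomial.eval (x n)
      (MvPolynomial.pderiv i (MvPolynomial.X j : MvPolynomial (Fin r) ℝ)) = δ n j := by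
    intro n
    rw [sum_eq_single j]
    · simp
    · intro i _ hij
      rw [MvPolynomial.pderiv_X_of_ne hij.symm]
      simp
    · simp
  refine ⟨?_, ?_, ?_, ?_, ?_⟩
  · simpa using hx j
  · exact (hδ j).congr h1
  · refine (powBound_zero _).congr fun n => ?_
    rw [h1]
    simp
  · have : balanced r (MvPolynomial.X j) = Polynomial.C (1 / (r : ℝ)) * Polynomial.X := by
      simp [balanced]
    rw [this]
    exact Polynomial.degree_C_mul_X_le _
  · intro i
    by_cases hij : j = i
    · subst hij
      rw [MvPolynomial.pderiv_X_self]
      refine (le_of_eq ?_).trans_lt (by norm_num : (0 : WithBot ℕ) < ((1 : ℕ) : WithBot ℕ))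
      simp [balanced]
    · rw [MvPolynomial.pderiv_X_of_ne hij]
      simp [balanced]

lemma HasExpansion.add {r : ℕ} {x δ : ℕ → Fin r → ℝ} {d : ℕ} {P Q : MvPolynomial (Fin r) ℝ}
    (hP : HasExpansion x δ d P) (hQ : HasExpansion x δ d Q) : HasExpansion x δ d (P + Q) where
  value := (hP.value.add hQ.value).congr fun n => by simp
  deriv := (hP.deriv.add hQ.deriv).congr fun n => by simp [mul_add, sum_add_distrib]
  rest := (hP.rest.add hQ.rest).congr fun n => by
    simp only [map_add, mul_add, sum_add_distrib]; ring
  degree_le := by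
    rw [balanced_add]
    exact (Polynomial.degree_add_le _ _).trans (max_le hP.degree_le hQ.degree_le)
  degree_lt i := by
    rw [map_add, balanced_add]
    exact (Polynomial.degree_add_le _ _).trans_lt (max_lt (hP.degree_lt i) (hQ.degree_lt i))

lemma degree_mul_lt_add {p q : Polynomial ℝ} {a b : ℕ} (hp : p.degree ≤ a) (hq : q.degree < b) :
    (p * q).degree < ((a + b : ℕ) : WithBot ℕ) := by
  by_cases h : p = 0
  · rw [h, zero_mul, Polynomial.degree_zero]
    exact WithBot.bot_lt_coe _
  · rw [Polynomial.degree_mul, Nat.cast_add]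
    exact WithBot.add_lt_add_of_le_of_lt (by simpa using h) hp hq

/-- Multiply value + derivative + rest for both factors. By the Leibniz rule, what remains beyond
first order is six products, each of order at most `d + d' - 2`. -/
lemma HasExpansion.mul {r : ℕ} {x δ : ℕ → Fin r → ℝ} {d d' m : ℕ} {P Q : MvPolynomial (Fin r) ℝ}
    (hP : HasExpansion x δ d P) (hQ : HasExpansion x δ d' Q) (hm : d + d' = m) :
    HasExpansion x δ m (P * Q) := by
  subst hm
  have hD : ∀ n, ∑ i, δ n i * MvPolynomial.eval (x n) (MvPolynomial.pderiv i (P * Q)) =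
      (∑ i, δ n i * MvPolynomial.eval (x n) (MvPolynomial.pderiv i P)) *
        MvPolynomial.eval (x n) Q + MvPolynomial.eval (x n) P *
      ∑ i, δ n i * MvPolynomial.eval (x n) (MvPolynomial.pderiv i Q) := by
    intro n
    rw [sum_mul, mul_sum, ← sum_add_distrib]
    refine sum_congr rfl fun i _ => ?_
    rw [Derivation.leibniz]
    simp only [smul_eq_mul, map_add, map_mul]
    ring
  refine ⟨?_, ?_, ?_, ?_, ?_⟩
  · exact (hP.value.mul hQ.value (by push_cast; ring)).congr fun n => by simp
  · exact ((hP.deriv.mul hQ.value (by push_cast; ring)).add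
      (hP.value.mul hQ.deriv (by push_cast; ring))).congr hD
  · have t1 := hP.deriv.mul hQ.deriv (m := ((d + d' : ℕ) : ℤ) - 2) (by push_cast; ring)
    have t2 := hP.value.mul hQ.rest (m := ((d + d' : ℕ) : ℤ) - 2) (by push_cast; ring)
    have t3 := hP.rest.mul hQ.value (m := ((d + d' : ℕ) : ℤ) - 2) (by push_cast; ring)
    have t4 := (hP.deriv.mul hQ.rest rfl).mono
      (show _ ≤ ((d + d' : ℕ) : ℤ) - 2 by push_cast; linarith)
    have t5 := (hP.rest.mul hQ.deriv rfl).mono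
      (show _ ≤ ((d + d' : ℕ) : ℤ) - 2 by push_cast; linarith)
    have t6 := (hP.rest.mul hQ.rest rfl).mono
      (show _ ≤ ((d + d' : ℕ) : ℤ) - 2 by push_cast; linarith)
    refine ((((((t1.add t2).add t3).add t4).add t5).add t6)).congr fun n => ?_
    rw [hD n, map_mul, map_mul]
    ring
  · rw [balanced_mul]
    refine (Polynomial.degree_mul_le _ _).trans ?_
    rw [Nat.cast_add]
    exact add_le_add hP.degree_le hQ.degree_le
  · intro i
    rw [Derivation.leibniz]
    simp only [smul_eq_mul]
    rw [balanced_add, balanced_mul, balanced_mul]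
    refine (Polynomial.degree_add_le _ _).trans_lt (max_lt ?_ ?_)
    · exact degree_mul_lt_add hP.degree_le (hQ.degree_lt i)
    · rw [add_comm]
      exact degree_mul_lt_add hQ.degree_le (hP.degree_lt i)

lemma HasExpansion.sum {r : ℕ} {x δ : ℕ → Fin r → ℝ} {d : ℕ} {ι : Type*} {s : Finset ι}
    {P : ι → MvPolynomial (Fin r) ℝ} (h : ∀ i ∈ s, HasExpansion x δ d (P i)) :
    HasExpansion x δ d (∑ i ∈ s, P i) := by
  induction s using Finset.induction_on with
  | empty => simpa using (hasExpansion_C x δ 0).mono (Nat.zero_le d)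
  | insert a s ha ih =>
    rw [sum_insert ha]
    exact (h a (by simp)).add (ih fun i hi => h i (by simp [hi]))

lemma HasExpansion.prod {r : ℕ} {x δ : ℕ → Fin r → ℝ} {ι : Type*} {s : Finset ι} {d : ι → ℕ}
    {P : ι → MvPolynomial (Fin r) ℝ} (h : ∀ i ∈ s, HasExpansion x δ (d i) (P i)) :
    HasExpansion x δ (∑ i ∈ s, d i) (∏ i ∈ s, P i) := by
  induction s using Finset.induction_on with
  | empty => simpa using hasExpansion_C x δ 1
  | insert a s ha ih =>
    rw [sum_insert ha, prod_insert ha]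
    exact (h a (by simp)).mul (ih fun i hi => h i (by simp [hi])) rfl

lemma HasExpansion.descPochhammer {r : ℕ} {x δ : ℕ → Fin r → ℝ} {Q : MvPolynomial (Fin r) ℝ}
    (hQ : HasExpansion x δ 1 Q) (k : ℕ) :
    HasExpansion x δ k (Polynomial.aeval Q (descPochhammer ℝ k)) := by
  induction k with
  | zero => simpa using hasExpansion_C x δ 1
  | succ k ih =>
    rw [descPochhammer_succ_right, map_mul]
    refine ih.mul ?_ rfl
    have : Polynomial.aeval Q (Polynomial.X - (k : Polynomial ℝ)) =
        Q + MvPolynomial.C (-(k : ℝ)) := by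
      simp [sub_eq_add_neg]
    rw [this]
    exact hQ.add ((hasExpansion_C x δ _).mono (by omega))

lemma card_notMem_edge {V : Type*} [Fintype V] {e : Sym2 V} (he : ¬ e.IsDiag) :
    #{w : V | w ∉ e} = Fintype.card V - 2 := by
  induction e with
  | _ u v =>
  have huv : u ≠ v := he
  have : ({w : V | w ∉ s(u, v)} : Finset V) = ({u, v} : Finset V)ᶜ := by
    ext w; simp
  rw [this, card_compl, card_pair huv]

lemma sum_card_color {V : Type*} [Fintype V] {r : ℕ} {e : Sym2 V} (he : ¬ e.IsDiag)
    (χ : V → Fin r) : ∑ i, #{w : V | w ∉ e ∧ χ w = i} = Fintype.card V - 2 := by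
  rw [← card_notMem_edge he, card_eq_sum_card_fiberwise (f := χ) (t := univ) (by simp)]
  simp only [filter_filter]

/-- In each summand the falling factorials have degrees adding up to `f - 2`, since the color
classes partition the vertices off the critical edge. -/
lemma hasExpansion_cPoly {V : Type*} [Fintype V] (F : SimpleGraph V) (r : ℕ) [r.AtLeastTwo]
    {x δ : ℕ → Fin r → ℝ} (hx : ∀ i, PowBound (fun n => x n i) 1)
    (hδ : ∀ i, PowBound (fun n => δ n i) 0) :
    HasExpansion x δ (Fintype.card V - 2) (cPoly F r) := by
  refine (hasExpansion_C x δ _).mul ?_ (zero_add _)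
  refine HasExpansion.sum fun e he => HasExpansion.sum fun χ _ => ?_
  have hd := F.not_isDiag_of_mem_edgeSet (mem_filter.1 he).2.1
  have h2 : HasExpansion x δ 0 (2 : MvPolynomial (Fin r) ℝ) := by
    rw [← map_ofNat MvPolynomial.C 2]
    exact hasExpansion_C x δ _
  refine h2.mul ?_ (zero_add _)
  rw [← sum_card_color hd χ]
  refine HasExpansion.prod fun i _ => HasExpansion.descPochhammer ?_ _
  split_ifs
  · have : (MvPolynomial.X i - 2 : MvPolynomial (Fin r) ℝ) =
        MvPolynomial.X i + MvPolynomial.C (-2) := by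
      rw [sub_eq_add_neg, map_neg, map_ofNat]
    rw [this]
    exact (hasExpansion_X hx hδ i).add ((hasExpansion_C x δ _).mono (by omega))
  · exact hasExpansion_X hx hδ i

/-- `c(n₁, …, n_r; F)` is symmetric in `n₂, …, n_r`. -/
lemma rename_cPoly {V : Type*} [Fintype V] (F : SimpleGraph V) (r : ℕ) [r.AtLeastTwo]
    (σ : Equiv.Perm (Fin r)) (hσ : σ 0 = 0) :
    MvPolynomial.rename σ (cPoly F r) = cPoly F r := by
  have hσ0 : ∀ i, σ i = 0 ↔ i = 0 := fun i => by
    rw [← hσ, σ.injective.eq_iff, hσ]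
  rw [cPoly, map_mul, MvPolynomial.rename_C, map_sum]
  congr 1
  refine sum_congr rfl fun e _ => ?_
  rw [map_sum]
  -- Recoloring by `σ` permutes the summation range because `σ` fixes the color of the critical
  -- edge.
  let T : (F.deleteEdges {e}).Coloring (Fin r) → (F.deleteEdges {e}).Coloring (Fin r) :=
    fun χ => Coloring.mk (fun w => σ (χ w)) fun {a b} hab h => χ.valid hab (σ.injective h)
  let T' : (F.deleteEdges {e}).Coloring (Fin r) → (F.deleteEdges {e}).Coloring (Fin r) :=
    fun χ => Coloring.mk (fun w => σ.symm (χ w)) fun {a b} hab h =>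
      χ.valid hab (σ.symm.injective h)
  have hT : ∀ χ w, T χ w = σ (χ w) := fun _ _ => rfl
  have hT' : ∀ χ w, T' χ w = σ.symm (χ w) := fun _ _ => rfl
  refine sum_bij' (fun χ _ => T χ) (fun χ _ => T' χ) ?_ ?_ ?_ ?_ ?_
  · intro χ hχ
    simp only [mem_filter, mem_univ, true_and, hT] at hχ ⊢
    exact fun w hw => by rw [hχ w hw, hσ]
  · intro χ hχ
    simp only [mem_filter, mem_univ, true_and, hT'] at hχ ⊢
    exact fun w hw => by rw [hχ w hw, Equiv.symm_apply_eq, hσ]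
  · intro χ _
    ext w
    rw [hT', hT, Equiv.symm_apply_apply]
  · intro χ _
    ext w
    rw [hT, hT', Equiv.apply_symm_apply]
  · intro χ _
    rw [map_mul, map_prod, map_ofNat]
    congr 1
    conv_rhs => rw [← Equiv.prod_comp σ]
    refine prod_congr rfl fun i _ => ?_
    rw [← Polynomial.aeval_algHom_apply]
    simp only [hT, σ.injective.eq_iff, hσ0]
    congr 1
    split_ifs
    · rw [map_sub, MvPolynomial.rename_X, map_ofNat]
    · rw [MvPolynomial.rename_X]

lemma eval_balanced {r : ℕ} (P : MvPolynomial (Fin r) ℝ) (n : ℕ) :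
    (balanced r P).eval (n : ℝ) = MvPolynomial.eval (fun _ => (n : ℝ) / r) P := by
  rw [balanced, ← Polynomial.coe_aeval_eq_eval, ← AlgHom.coe_toRingHom, RingHom.coe_coe,
    MvPolynomial.comp_aeval_apply, ← MvPolynomial.coe_aeval_eq_eval, RingHom.coe_coe]
  congr 2
  funext i
  simp
  ring

/-- By symmetry all partial derivatives but the first agree at balanced points, which is why the
single number `ζ_F` governs the first order. -/
lemma balanced_pderiv_cPoly {V : Type*} [Fintype V] (F : SimpleGraph V) (r : ℕ) [r.AtLeastTwo]
    (i : Fin r) (hi : i ≠ 0) :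
    balanced r (MvPolynomial.pderiv i (cPoly F r)) =
      balanced r (MvPolynomial.pderiv 1 (cPoly F r)) := by
  have h10 : (1 : Fin r) ≠ 0 := by
    intro h
    have h' := congrArg Fin.val h
    rw [Fin.val_one', Nat.mod_eq_of_lt Nat.AtLeastTwo.one_lt] at h'
    exact absurd h' one_ne_zero
  have hσ : Equiv.swap 1 i (0 : Fin r) = 0 := Equiv.swap_apply_of_ne_of_ne h10.symm hi.symm
  have h := MvPolynomial.pderiv_rename (Equiv.swap 1 i).injective 1 (cPoly F r)
  rw [rename_cPoly F r _ hσ, Equiv.swap_apply_left] at h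
  rw [h, balanced, MvPolynomial.aeval_rename]
  rfl

/-- The value of `c` near the balanced point, to second order. -/
lemma powBound_cPoly_sub {V : Type*} [Fintype V] (F : SimpleGraph V) (r : ℕ) [r.AtLeastTwo]
    (hV : 3 ≤ Fintype.card V) (δ : ℕ → Fin r → ℝ) (K : ℝ) (hδ : ∀ n i, |δ n i| ≤ K)
    (hsum : ∀ n, ∑ i, δ n i = 0) :
    PowBound (fun n => MvPolynomial.eval (fun i => (n : ℝ) / r + δ n i) (cPoly F r) -
      MvPolynomial.eval (fun _ => (n : ℝ) / r) (cPoly F r) +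
        δ n 0 * (zeta F r * (n : ℝ) ^ (Fintype.card V - 3))) ((Fintype.card V : ℤ) - 4) := by
  have hx : ∀ i : Fin r, PowBound (fun n => (fun (m : ℕ) (_ : Fin r) => (m : ℝ) / r) n i) 1 :=
    fun i => ((powBound_const (1 / (r : ℝ))).mul powBound_natCast (zero_add 1)).congr
      fun n => by ring
  have hδ' : ∀ i, PowBound (fun n => δ n i) 0 := fun i => PowBound.of_abs_le K fun n => hδ n i
  have hE := hasExpansion_cPoly F r hx hδ'
  set q := balanced r (MvPolynomial.pderiv 1 (cPoly F r)) -
    balanced r (MvPolynomial.pderiv 0 (cPoly F r)) with hq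
  have hqdeg : q.natDegree ≤ Fintype.card V - 3 := by
    have h1 : q.degree < ((Fintype.card V - 2 : ℕ) : WithBot ℕ) :=
      (Polynomial.degree_sub_le _ _).trans_lt (max_lt (hE.degree_lt 1) (hE.degree_lt 0))
    by_cases hq0 : q = 0
    · simp [hq0]
    · have := (Polynomial.natDegree_lt_iff_degree_lt hq0).2 h1
      omega
  -- Since the increments sum to 0 and the derivatives for `i ≠ 0` agree, only `δ n 0 * (∂₁c - ∂₂c)`
  -- survives.
  have hder : ∀ n : ℕ, ∑ i, δ n i * MvPolynomial.eval (fun _ => (n : ℝ) / r)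
      (MvPolynomial.pderiv i (cPoly F r)) = - (δ n 0 * q.eval (n : ℝ)) := by
    intro n
    have h1 : ∀ i, δ n i * MvPolynomial.eval (fun _ => (n : ℝ) / r)
        (MvPolynomial.pderiv i (cPoly F r)) =
        δ n i * (balanced r (MvPolynomial.pderiv 1 (cPoly F r))).eval (n : ℝ) -
          if i = 0 then δ n i * q.eval (n : ℝ) else 0 := by
      intro i
      rw [← eval_balanced]
      split_ifs with hi
      · subst hi
        rw [hq, Polynomial.eval_sub]
        ring
      · rw [balanced_pderiv_cPoly F r i hi, sub_zero]
    rw [sum_congr rfl fun i _ => h1 i, sum_sub_distrib, ← sum_mul, hsum]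
    simp
  have h1 := hE.rest.mono (show _ ≤ (Fintype.card V : ℤ) - 4 by omega)
  have h2 := ((hδ' 0).mul (powBound_eval_sub_leading q hqdeg) (zero_add _)).mono
    (show _ ≤ (Fintype.card V : ℤ) - 4 by omega)
  refine (h1.sub h2).congr fun n => ?_
  rw [hder n, zeta, ← hq]
  simp only [Pi.add_def]
  ring

lemma powBound_cPoly_balanced {V : Type*} [Fintype V] (F : SimpleGraph V) (r : ℕ) [r.AtLeastTwo]
    (hV : 3 ≤ Fintype.card V) :
    PowBound (fun n => MvPolynomial.eval (fun _ => (n : ℝ) / r) (cPoly F r) -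
      alpha F r * (n : ℝ) ^ (Fintype.card V - 2)) ((Fintype.card V : ℤ) - 3) := by
  have hx : ∀ i : Fin r, PowBound (fun n => (fun (m : ℕ) (_ : Fin r) => (m : ℝ) / r) n i) 1 :=
    fun i => ((powBound_const (1 / (r : ℝ))).mul powBound_natCast (zero_add 1)).congr
      fun n => by ring
  have hE := hasExpansion_cPoly F r hx (δ := fun _ _ => 0) (fun i => powBound_zero 0)
  refine ((powBound_eval_sub_leading _
    (Polynomial.natDegree_le_of_degree_le hE.degree_le)).mono
    (show _ ≤ (Fintype.card V : ℤ) - 3 by omega)).congr fun n => ?_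
  rw [eval_balanced, alpha]

/-! ### Construction of the competing graph. -/

lemma card_edgeFinset_fromEdgeSet {W : Type*} [Fintype W] {S : Finset (Sym2 W)}
    [Fintype (fromEdgeSet (S : Set (Sym2 W))).edgeSet] (hS : ∀ e ∈ S, ¬ e.IsDiag) : #(fromEdgeSet (S : Set (Sym2 W))).edgeFinset = #S := by
  congr 1
  ext e
  rw [mem_edgeFinset, edgeSet_fromEdgeSet, Set.mem_sdiff, mem_coe]
  exact ⟨fun h => h.1, fun h => ⟨h, hS e h⟩⟩

/-- Disjoint unions of complete balanced bipartite graphs inside the first part have block graphs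
of every smaller size as subgraphs. -/
lemma exists_isBlockGraph {W : Type*} [Fintype W] {r : ℕ} [NeZero r] (p : W → Fin r)
    {D K q : ℕ} (hD : 0 < D) (hK : 2 * D * K ≤ partSize p 0) (hq : q ≤ K * (D * D)) :
    ∃ (B : SimpleGraph W) (blk : W → ℕ) (lab : W → Fin (2 * D)),
      IsBlockGraph p (2 * D) B blk lab ∧ #B.edgeFinset = q := by
  have hcard : Fintype.card {w // p w = 0} = partSize p 0 := by
    rw [Fintype.card_subtype, partSize]
    congr!
  let E := Fintype.equivFinOfCardEq hcard
  let num : W → ℕ := fun w => if h : p w = 0 then (E ⟨w, h⟩ : ℕ) else 0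
  have hnum : ∀ x y, p x = 0 → p y = 0 → num x = num y → x = y := by
    intro x y hx hy h
    simp only [num, hx, hy, dif_pos] at h
    exact congrArg Subtype.val (E.injective (Fin.ext h))
  let blk : W → ℕ := fun w => num w / (2 * D)
  let lab : W → Fin (2 * D) := fun w => ⟨num w % (2 * D), Nat.mod_lt _ (by omega)⟩
  let vert : Fin (partSize p 0) → W := fun i => (E.symm i).1
  have hvert : ∀ i, p (vert i) = 0 := fun i => (E.symm i).2
  have hnv : ∀ i, num (vert i) = i := by
    intro i
    simp only [num, vert, (E.symm i).2, dif_pos, Subtype.coe_eta, Equiv.apply_symm_apply]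
  have hbound : ∀ (k : Fin K) (a : ℕ), a < 2 * D → 2 * D * k + a < partSize p 0 := by
    intro k a ha
    have : 2 * D * (k + 1) ≤ 2 * D * K := Nat.mul_le_mul_left _ k.2
    rw [Nat.mul_add] at this
    omega
  -- Block `k` carries a complete bipartite graph between its first and its second `D` vertices.
  let edge : Fin K × Fin D × Fin D → Sym2 W := fun z =>
    s(vert ⟨2 * D * z.1 + z.2.1, hbound z.1 _ (by omega)⟩,
      vert ⟨2 * D * z.1 + (D + z.2.2), hbound z.1 _ (by omega)⟩)
  have hdiv : ∀ (k a : ℕ), a < D → (2 * D * k + a) / D = 2 * k ∧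
      (2 * D * k + (D + a)) / D = 2 * k + 1 := by
    intro k a ha
    have e1 : 2 * D * k + a = a + D * (2 * k) := by ring
    have e2 : 2 * D * k + (D + a) = a + D * (2 * k + 1) := by ring
    rw [e1, e2, Nat.add_mul_div_left _ _ hD, Nat.add_mul_div_left _ _ hD, Nat.div_eq_of_lt ha]
    simp
  have hinj : Function.Injective edge := by
    rintro ⟨k, a, b⟩ ⟨k', a', b'⟩ h
    have hv : ∀ i j, vert i = vert j → (i : ℕ) = j := fun i j h => by
      rw [← hnv i, ← hnv j, h]
    obtain ⟨d1, -⟩ := hdiv k a a.2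
    obtain ⟨-, d2⟩ := hdiv k b b.2
    obtain ⟨d1', -⟩ := hdiv k' a' a'.2
    obtain ⟨-, d2'⟩ := hdiv k' b' b'.2
    rcases Sym2.eq_iff.1 h with ⟨h1, h2⟩ | ⟨h1, h2⟩
    · have h1 := hv _ _ h1
      have h2 := hv _ _ h2
      simp only at h1 h2
      have hk : (k : ℕ) = k' := by rw [h1] at d1; omega
      rw [hk] at h1 h2
      simp only [Prod.mk.injEq, Fin.ext_iff]
      omega
    · have h1 := hv _ _ h1
      simp only at h1
      rw [h1] at d1
      omega
  obtain ⟨S, hS, hScard⟩ := exists_subset_card_eq (s := univ.image edge) (n := q) (by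
    rw [card_image_of_injective _ hinj, card_univ]
    simpa using hq)
  -- The parity of `num / D` tells the halves of a block apart; being a 2-coloring, it excludes
  -- triangles.
  have hSE : ∀ x y, s(x, y) ∈ S → p x = 0 ∧ p y = 0 ∧ blk x = blk y ∧
      num x / D % 2 ≠ num y / D % 2 := by
    intro x y hxy
    obtain ⟨⟨k, a, b⟩, -, hz⟩ := mem_image.1 (hS hxy)
    have hb1 : (2 * D * (k : ℕ) + a) / (2 * D) = k := by
      rw [add_comm, Nat.add_mul_div_left _ _ (by omega), Nat.div_eq_of_lt (by omega), zero_add]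
    have hb2 : (2 * D * (k : ℕ) + (D + b)) / (2 * D) = k := by
      rw [add_comm, Nat.add_mul_div_left _ _ (by omega), Nat.div_eq_of_lt (by omega), zero_add]
    obtain ⟨d1, -⟩ := hdiv k a a.2
    obtain ⟨-, d2⟩ := hdiv k b b.2
    rcases Sym2.eq_iff.1 hz with ⟨rfl, rfl⟩ | ⟨rfl, rfl⟩
    · refine ⟨hvert _, hvert _, ?_, ?_⟩
      · simp only [blk, hnv]
        rw [hb1, hb2]
      · simp only [hnv]
        rw [d1, d2]
        omega
    · refine ⟨hvert _, hvert _, ?_, ?_⟩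
      · simp only [blk, hnv]
        rw [hb1, hb2]
      · simp only [hnv]
        rw [d1, d2]
        omega
  refine ⟨fromEdgeSet (S : Set (Sym2 W)), blk, lab, ⟨?_, ?_, ?_, ?_⟩, ?_⟩
  · intro x y h
    exact (hSE x y ((fromEdgeSet_adj _).1 h).1).1
  · intro x y h
    exact (hSE x y ((fromEdgeSet_adj _).1 h).1).2.2.1
  · intro x y hx hy hb hl
    refine hnum x y hx hy ?_
    have hl' : num x % (2 * D) = num y % (2 * D) := congrArg Fin.val hl
    have hb' : num x / (2 * D) = num y / (2 * D) := hb
    rw [← Nat.div_add_mod (num x) (2 * D), ← Nat.div_add_mod (num y) (2 * D), hl', hb']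
  · intro x y z hxy hyz hxz
    have h1 := (hSE x y ((fromEdgeSet_adj _).1 hxy).1).2.2.2
    have h2 := (hSE y z ((fromEdgeSet_adj _).1 hyz).1).2.2.2
    have h3 := (hSE x z ((fromEdgeSet_adj _).1 hxz).1).2.2.2
    omega
  · have hd : ∀ e ∈ S, ¬ e.IsDiag := by
      intro e he hd
      induction e with
      | _ x y =>
      have := (hSE x y he).2.2.2
      rw [Sym2.mk_isDiag_iff] at hd
      exact this (by rw [hd])
    rw [← hScard]
    convert! card_edgeFinset_fromEdgeSet hd

lemma card_edges_multipartite_sup {W : Type*} [Fintype W] {r D : ℕ} [NeZero r] {p : W → Fin r}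
    {B : SimpleGraph W} {blk : W → ℕ} {lab : W → Fin D} (hB : IsBlockGraph p D B blk lab) :
    #(multipartite p ⊔ B).edgeFinset = #(multipartite p).edgeFinset + #B.edgeFinset := by
  rw [← card_union_of_disjoint]
  · congr 1
    ext e
    simp only [mem_edgeFinset, mem_union, edgeSet_sup, Set.mem_union]
  · rw [Finset.disjoint_left]
    intro e he he'
    rw [mem_edgeFinset] at he he'
    induction e with
    | _ x y =>
    exact he ((hB.left_part _ _ he').trans (hB.left_part _ _ (show B.Adj x y from he').symm).symm)

/-- Moving a vertex from part `b` to part `a`. -/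
lemma exists_move_vertex {W : Type*} [Fintype W] {r : ℕ} (p : W → Fin r) {a b : Fin r}
    (hb : 0 < partSize p b) :
    ∃ p' : W → Fin r, ∀ i, (partSize p' i : ℝ) =
      partSize p i + (if i = a then 1 else 0) - if i = b then 1 else 0 := by
  obtain ⟨z, hz⟩ := card_pos.1 hb
  have hz : p z = b := by simpa using hz
  refine ⟨Function.update p z a, fun i => ?_⟩
  have h1 : ∀ p' : W → Fin r, (partSize p' i : ℝ) =
      (if p' z = i then 1 else 0) + ∑ w ∈ univ.erase z, if p' w = i then 1 else 0 := by
    intro p'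
    rw [partSize, card_filter, ← add_sum_erase _ _ (mem_univ z)]
    push_cast
    congr!
  rw [h1, h1, Function.update_self, hz]
  have h2 : ∑ w ∈ univ.erase z, (if Function.update p z a w = i then (1 : ℝ) else 0) =
      ∑ w ∈ univ.erase z, if p w = i then (1 : ℝ) else 0 := by
    refine sum_congr rfl fun w hw => ?_
    rw [Function.update_of_ne (ne_of_mem_erase hw)]
  rw [h2]
  simp only [eq_comm (a := a), eq_comm (a := b)]
  ring

lemma partSize_perm_comp {W : Type*} [Fintype W] {r : ℕ} (p : W → Fin r)
    (s t : Fin r) (i : Fin r) :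
    partSize (fun w => Equiv.swap s t (p w)) i = partSize p (Equiv.swap s t i) := by
  simp only [partSize]
  congr 1
  ext x
  simp only [mem_filter, mem_univ, true_and]
  rw [← Equiv.eq_symm_apply, Equiv.symm_swap]

/-- The loss of edges when a vertex is moved from part `b` to part `a`. -/
lemma card_edges_move {W : Type*} [Fintype W] {r : ℕ} (p p' : W → Fin r) {a b : Fin r}
    (hab : a ≠ b) (σ : Equiv.Perm (Fin r)) (h : ∀ i, (partSize p' i : ℝ) =
      partSize p (σ i) + (if σ i = a then 1 else 0) - if σ i = b then 1 else 0) :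
    (#(multipartite p).edgeFinset : ℝ) =
      #(multipartite p').edgeFinset + (partSize p a - partSize p b + 1) := by
  have h1 := two_mul_card_edges_multipartite p
  have h2 := two_mul_card_edges_multipartite p'
  have h1' : (2 : ℝ) * #(multipartite p).edgeFinset + ∑ i, (partSize p i : ℝ) ^ 2 =
      (Fintype.card W : ℝ) ^ 2 := by exact_mod_cast h1
  have h2' : (2 : ℝ) * #(multipartite p').edgeFinset + ∑ i, (partSize p' i : ℝ) ^ 2 =
      (Fintype.card W : ℝ) ^ 2 := by exact_mod_cast h2
  have h3 : ∑ i, (partSize p' i : ℝ) ^ 2 = ∑ i, ((partSize p i : ℝ) +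
      (if i = a then 1 else 0) - if i = b then 1 else 0) ^ 2 :=
    (sum_congr rfl fun i _ => by rw [h]).trans (Equiv.sum_comp σ fun i => ((partSize p i : ℝ) +
      (if i = a then 1 else 0) - if i = b then 1 else 0) ^ 2)
  -- The sum of squares grows by `2 * (|V_a| - |V_b| + 1)`, hence the loss of edges is half of that.
  have h4 : ∀ i, ((partSize p i : ℝ) + (if i = a then 1 else 0) - if i = b then 1 else 0) ^ 2 =
      (partSize p i : ℝ) ^ 2 + (if i = a then 2 * (partSize p i : ℝ) + 1 else 0) -
        if i = b then 2 * (partSize p i : ℝ) - 1 else 0 := by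
    intro i
    by_cases ha : i = a
    · have : i ≠ b := fun h => hab (ha.symm.trans h)
      simp only [ha, hab, if_true, if_false]; ring
    · by_cases hb : i = b
      · simp only [hb, hab.symm, if_true, if_false]; ring
      · simp only [ha, hb, if_false]; ring
  rw [h3, sum_congr rfl fun i _ => h4 i, sum_sub_distrib, sum_add_distrib] at h2'
  simp only [sum_ite_eq', mem_univ, if_true] at h2'
  linarith

/-! ### Bounds on `t_F` and `h_F`. -/

lemma not_colorable_of_isCritical {V : Type*} {F : SimpleGraph V} {r : ℕ}
    (h : IsCritical F r) : ¬ F.Colorable r := by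
  intro hc
  have h1 := hc.chromaticNumber_le
  rw [h.1] at h1
  exact absurd (Nat.cast_le.1 h1) (by omega)

lemma exists_colorable_deleteEdges {V : Type*} {F : SimpleGraph V} {r : ℕ}
    (h : IsCritical F r) : ∃ e, (F.deleteEdges {e}).Colorable r := by
  obtain ⟨e, -, he⟩ := h.2
  exact ⟨e, chromaticNumber_le_iff_colorable.1 he.le⟩

/-- Keeps the exponents `f - 2` and `f - 3` free of truncation. -/
lemma three_le_card_of_isCritical {V : Type*} [Fintype V] {F : SimpleGraph V} {r : ℕ}
    (hr : 2 ≤ r) (h : IsCritical F r) : 3 ≤ Fintype.card V := by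
  by_contra! hlt
  exact not_colorable_of_isCritical h (F.colorable_of_fintype.mono (by omega))

lemma ncard_edgeSet {W : Type*} [Fintype W] (G : SimpleGraph W) :
    G.edgeSet.ncard = #G.edgeFinset := by
  rw [← coe_edgeFinset, Set.ncard_coe_finset]

lemma card_edges_turanGraph (n r : ℕ) [NeZero r] :
    #(turanGraph n r).edgeFinset = #(multipartite (residue n r)).edgeFinset := by
  congr! 2
  exact turanGraph_eq_multipartite n r

/-- A lower bound on `t_F(n, q)`. -/
lemma eventually_mul_le_tFun {V : Type*} [Fintype V] {F : SimpleGraph V} {r : ℕ} [r.AtLeastTwo]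
    (hF : IsCritical F r) : ∀ᶠ n in atTop, ∀ (q : ℕ) (m : ℝ),
      extremalNumber n F + q ≤ n.choose 2 →
      (∀ a, m ≤ MvPolynomial.eval
        (fun i => (partSize (residue n r) (Equiv.swap 0 a i) : ℝ)) (cPoly F r)) →
      q * m ≤ tFun F n q := by
  have hcol := not_colorable_of_isCritical hF
  obtain ⟨e, he⟩ := exists_colorable_deleteEdges hF
  filter_upwards [eventually_iso_turanGraph Nat.AtLeastTwo.prop hcol he] with n hn q m hq hm
  -- Nonemptiness matters: the infimum of the empty set would be 0 and the lower bound could fail.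
  have hne : {m : ℕ | ∃ G₀ G : SimpleGraph (Fin n),
      F.Free G₀ ∧ G₀.edgeSet.ncard = extremalNumber n F ∧
      G₀ ≤ G ∧ G.edgeSet.ncard = extremalNumber n F + q ∧ G.copyCount F = m}.Nonempty := by
    obtain ⟨G₀, hG₀⟩ : ∃ G₀, G₀ = turanGraph n r := ⟨_, rfl⟩
    have h0 : G₀.edgeSet.ncard = extremalNumber n F := by
      rw [hn.1, ncard_edgeSet]
      congr!
    have htop : #(⊤ : SimpleGraph (Fin n)).edgeFinset = n.choose 2 := by
      have := card_edgeFinset_top_eq_card_choose_two (V := Fin n)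
      rw [Fintype.card_fin] at this
      convert! this
    obtain ⟨S, hS1, hS2, hS3⟩ := exists_subsuperset_card_eq
      (s := G₀.edgeFinset) (t := (⊤ : SimpleGraph (Fin n)).edgeFinset)
      (n := extremalNumber n F + q) (edgeFinset_mono le_top)
      (by rw [← ncard_edgeSet, h0]; omega) (by rw [htop]; exact hq)
    refine ⟨_, G₀, fromEdgeSet (S : Set (Sym2 (Fin n))), hG₀ ▸ free_turanGraph hcol n, h0, ?_, ?_, rfl⟩
    · intro x y hxy
      rw [fromEdgeSet_adj]
      exact ⟨hS1 (mem_edgeFinset.2 hxy), hxy.ne⟩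
    · rw [ncard_edgeSet, ← hS3]
      have hd : ∀ e ∈ S, ¬ e.IsDiag := fun e he =>
        (⊤ : SimpleGraph (Fin n)).not_isDiag_of_mem_edgeSet (mem_edgeFinset.1 (hS2 he))
      convert! card_edgeFinset_fromEdgeSet hd
  obtain ⟨G₀, G, hfree, h0, hle, hG, hcount⟩ := Nat.sInf_mem hne
  change _ ≤ ((sInf _ : ℕ) : ℝ)
  rw [← hcount]
  rw [ncard_edgeSet] at h0 hG
  obtain ⟨φ⟩ := hn.2 G₀ hfree h0
  let p : Fin n → Fin r := fun v => residue n r (φ v)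
  have hT : ∀ x y, (turanGraph n r).Adj x y ↔ residue n r x ≠ residue n r y := by
    intro x y
    rw [turanGraph_eq_multipartite]
    rfl
  have hp : multipartite p = G₀ := by
    ext v w
    rw [← φ.map_adj_iff, hT]
    rfl
  have hsize : ∀ i, partSize p i = partSize (residue n r) i := by
    intro i
    refine card_bij (fun v _ => φ v) (fun v hv => ?_) (fun v _ w _ h => φ.injective h)
      fun w hw => ⟨φ.symm w, ?_, φ.apply_symm_apply w⟩
    · simpa [p] using hv
    · simpa [p] using hw
  have h1 := mul_le_copyCount hcol p (hp.trans_le hle) m (fun a => by simpa only [hsize] using hm a)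
  have h2 : #(multipartite p).edgeFinset = extremalNumber n F := by
    rw [← h0]
    congr! 2
  rw [h2, hG] at h1
  push_cast at h1
  rwa [add_sub_cancel_left] at h1

/-- An upper bound on `h_F(n, q)`. -/
lemma hFun_le {V : Type*} [Fintype V] {F : SimpleGraph V} {r : ℕ} [r.AtLeastTwo]
    (hF : IsPairFree F r) {n q D : ℕ} {p : Fin n → Fin r} {B : SimpleGraph (Fin n)}
    {blk : Fin n → ℕ} {lab : Fin n → Fin D} (hB : IsBlockGraph p D B blk lab)
    (hq : #(multipartite p).edgeFinset + #B.edgeFinset = extremalNumber n F + q) :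
    (hFun F n q : ℝ) ≤
      #B.edgeFinset * MvPolynomial.eval (fun i => (partSize p i : ℝ)) (cPoly F r) +
        (Fintype.card V ^ 6 * D ^ 3 : ℕ) * (n : ℝ) ^ (Fintype.card V - 3) := by
  have h1 := copyCount_le (not_colorable_of_isCritical hF.1) hF p hB
  rw [Fintype.card_fin] at h1
  refine le_trans ?_ h1
  refine Nat.cast_le.2 (Nat.sInf_le ⟨multipartite p ⊔ B, ?_, rfl⟩)
  rw [ncard_edgeSet, ← hq]
  convert! card_edges_multipartite_sup hB

/-! ### Comparison of the two counts, and the limit inferior. -/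

lemma PowBound.exists_bound {u : ℕ → ℝ} {k : ℕ} (h : PowBound u k) :
    ∃ C, 0 ≤ C ∧ ∀ᶠ n : ℕ in atTop, |u n| ≤ C * (n : ℝ) ^ k := by
  obtain ⟨C, hC, h⟩ := IsBigO.exists_nonneg h
  refine ⟨C, hC, ?_⟩
  filter_upwards [h.bound] with n hn
  simpa using hn

/-- For `k = f - 3` the exponent is -1 when f = 3, hence the quotient form. -/
lemma PowBound.exists_bound_div {u : ℕ → ℝ} {k : ℕ} (h : PowBound u ((k : ℤ) - 1)) :
    ∃ C, 0 ≤ C ∧ ∀ᶠ n : ℕ in atTop, |u n| ≤ C * ((n : ℝ) ^ k / n) := by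
  obtain ⟨C, hC, h⟩ := IsBigO.exists_nonneg h
  refine ⟨C, hC, ?_⟩
  filter_upwards [h.bound, eventually_ge_atTop 1] with n hn h1
  have hn' : (n : ℝ) ≠ 0 := by exact_mod_cast (by omega : n ≠ 0)
  rw [Real.norm_eq_abs, zpow_sub_one₀ hn', zpow_natCast, ← div_eq_mul_inv,
    Real.norm_of_nonneg (by positivity)] at hn
  exact hn

lemma abs_partSize_residue_sub_le (n r : ℕ) [NeZero r] (i : Fin r) :
    |(partSize (residue n r) i : ℝ) - n / r| ≤ 1 := by
  have hr : (0 : ℝ) < r := by exact_mod_cast NeZero.pos r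
  have h1 : ((n / r : ℕ) : ℝ) ≤ n / r := Nat.cast_div_le
  have h2 : (n : ℝ) / r < (n / r : ℕ) + 1 := by
    rw [div_lt_iff₀ hr]
    have := Nat.lt_succ_of_le (le_refl (n / r))
    have h3 := (Nat.div_lt_iff_lt_mul (NeZero.pos r)).1 this
    exact_mod_cast h3
  rw [partSize_residue, abs_le]
  split_ifs <;> push_cast <;> constructor <;> linarith

lemma sum_partSize_residue_sub (n r : ℕ) [NeZero r] (σ : Equiv.Perm (Fin r)) :
    ∑ i, ((partSize (residue n r) (σ i) : ℝ) - n / r) = 0 := by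
  have hr : (r : ℝ) ≠ 0 := by exact_mod_cast NeZero.ne r
  have h1 := sum_partSize (residue n r)
  rw [← Equiv.sum_comp σ, Fintype.card_fin] at h1
  have h2 : ∑ i, (partSize (residue n r) (σ i) : ℝ) = n := by exact_mod_cast h1
  rw [sum_sub_distrib, h2]
  simp
  field_simp
  simp

/-- Positivity of `q` excludes the default value 0 of the supremum of an empty set; otherwise the
set is bounded and the supremum attained. -/
lemma qFun_spec {V : Type*} {F : SimpleGraph V} {n q : ℕ} (hq : 0 < q) (hle : q ≤ qFun F n) :
    extremalNumber n F + q ≤ n.choose 2 ∧ hFun F n q = tFun F n q := by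
  have hne : {q : ℕ | extremalNumber n F + q ≤ n.choose 2 ∧
      ∀ q' ≤ q, hFun F n q' = tFun F n q'}.Nonempty := by
    by_contra! h
    rw [qFun, h] at hle
    simp at hle
    omega
  have hbdd : BddAbove {q : ℕ | extremalNumber n F + q ≤ n.choose 2 ∧
      ∀ q' ≤ q, hFun F n q' = tFun F n q'} := ⟨n.choose 2, fun x hx => by have := hx.1; omega⟩
  obtain ⟨h1, h2⟩ := Nat.sSup_mem hne hbdd
  exact ⟨(Nat.add_le_add_left hle _).trans h1, h2 q hle⟩

/-- Blocks of `2 * D` vertices with `D * D` edges fit about `D * n / (2 * r)` edges into a part, so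
a constant `D` depending on `β` and `r` suffices. -/
lemma eventually_div_sub_ge (r : ℕ) [NeZero r] {D : ℕ} (hD : 0 < D) {β L : ℝ}
    (hβ : (β + 2) * (2 * r) ≤ D) : ∀ᶠ n : ℕ in atTop, ∀ P : ℕ, (n : ℝ) / r - 3 ≤ P →
      β * n + 1 + L ≤ ((P / (2 * D) : ℕ) : ℝ) * (D * D) := by
  have hr : (0 : ℝ) < r := by exact_mod_cast NeZero.pos r
  have hD' : (0 : ℝ) < D := by exact_mod_cast hD
  filter_upwards [eventually_ge_atTop ⌈(1 + L + D * (3 + 2 * D)) / 2⌉₊] with n hn P hP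
  have hn' := Nat.ceil_le.1 hn
  have h1 : (P : ℝ) < 2 * D * ((P / (2 * D) : ℕ) + 1) := by
    exact_mod_cast Nat.lt_mul_div_succ P (by omega)
  have h2 : (n : ℝ) * (β + 2) * 2 ≤ D * (n / r) := by
    have : (n : ℝ) * (β + 2) * 2 = (β + 2) * (2 * r) * (n / r) := by field_simp
    rw [this]
    exact mul_le_mul_of_nonneg_right hβ (by positivity)
  have h3 : D * ((n : ℝ) / r - 3) ≤ D * (2 * D * ((P / (2 * D) : ℕ) + 1)) :=
    mul_le_mul_of_nonneg_left (hP.trans h1.le) hD'.le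
  have h4 : 1 + L + D * (3 + 2 * D) ≤ 2 * (n : ℝ) := by linarith
  nlinarith [h2, h3, h4]

/-- Here `Y = n ^ (f - 3)`, `m` and `x` are the copies per inner edge in the Turán graph and in the
competitor, and `z = |ζ|`. The competitor saves `z * Y` on each of `q` edges and pays about `α * n *
Y` for each of `L` extra ones; dividing by `Y` leaves a linear term bounded by a constant. -/
lemma le_of_count_bounds {n Y q m x c₀ d z ζ ε β α L C₁ C₂ C₃ C₄ : ℝ} (hn : 1 ≤ n) (hY : 0 < Y)
    (hq1 : β * n ≤ q) (hq2 : q ≤ (β + 1) * n) (hq0 : 0 ≤ q) (hL : 0 ≤ L) (h2 : 0 ≤ C₂)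
    (h1 : 0 ≤ C₁) (hz : ε * ζ = z) (hz0 : 0 ≤ z) (hd : -(d * ζ) ≤ z)
    (hm : m = c₀ - d * (ζ * Y) - C₁ * (Y / n))
    (hx : x ≤ c₀ - (d + ε) * (ζ * Y) + C₂ * (Y / n)) (hc : c₀ ≤ α * (n * Y) + C₃ * Y)
    (hcount : q * m ≤ (q + L) * x + C₄ * Y) :
    (β * z - L * α) * n ≤ (β + 1) * (C₁ + C₂) + L * (C₂ + C₃) + C₄ := by
  have hn0 : 0 < n := by linarith
  have hYn : Y / n ≤ Y := div_le_self hY.le hn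
  have hqY : q * (Y / n) ≤ (β + 1) * Y := by
    rw [mul_div_assoc', div_le_iff₀ hn0]
    nlinarith
  have hx1 : x ≤ m - z * Y + (C₁ + C₂) * (Y / n) := by
    rw [hm, ← hz]; linarith
  have hx2 : x ≤ α * (n * Y) + (C₂ + C₃) * Y := by
    have e1 : (d + ε) * (ζ * Y) = (d * ζ + z) * Y := by rw [← hz]; ring
    have e2 : 0 ≤ (d * ζ + z) * Y := mul_nonneg (by linarith) hY.le
    have e3 : C₂ * (Y / n) ≤ C₂ * Y := mul_le_mul_of_nonneg_left hYn h2
    linarith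
  have t1 : q * x ≤ q * (m - z * Y + (C₁ + C₂) * (Y / n)) := mul_le_mul_of_nonneg_left hx1 hq0
  have t2 : L * x ≤ L * (α * (n * Y) + (C₂ + C₃) * Y) := mul_le_mul_of_nonneg_left hx2 hL
  have t3 : (C₁ + C₂) * (q * (Y / n)) ≤ (C₁ + C₂) * ((β + 1) * Y) :=
    mul_le_mul_of_nonneg_left hqY (by linarith)
  have t4 : β * n * (z * Y) ≤ q * (z * Y) :=
    mul_le_mul_of_nonneg_right hq1 (mul_nonneg hz0 hY.le)
  refine le_of_mul_le_mul_right ?_ hY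
  linarith

/-- The bound on `q_F(n)` obtained by moving a vertex from part `b` to part `a`, and then placing
the additional edges in part `s`, which is one of these two. -/
lemma eventually_qFun_le {V : Type*} [Fintype V] {F : SimpleGraph V} {r : ℕ} [r.AtLeastTwo]
    (hF : IsPairFree F r) {a b s : Fin r} {ε : ℝ} (hab : a ≠ b)
    (hs : s = a ∧ ε = 1 ∨ s = b ∧ ε = -1) (hε : ε * zeta F r = |zeta F r|)
    (hext : ∀ n j, ε * partSize (residue n r) j ≤ ε * partSize (residue n r) s)
    {L : ℕ} {β : ℝ} (hβ0 : 0 < β) (hβ : L * alpha F r < β * |zeta F r|) :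
    ∀ᶠ n in atTop, partSize (residue n r) a + 1 = partSize (residue n r) b + L →
      (qFun F n : ℝ) ≤ β * n := by
  have hr : (0 : ℝ) < r := by exact_mod_cast NeZero.pos r
  obtain ⟨f, hf⟩ := Nat.exists_eq_add_of_le (three_le_card_of_isCritical Nat.AtLeastTwo.prop hF.1)
  have hV : 3 ≤ Fintype.card V := by omega
  have hε1 : ε * ε = 1 := by rcases hs with ⟨-, rfl⟩ | ⟨-, rfl⟩ <;> norm_num
  have hεabs : |ε| = 1 := by rcases hs with ⟨-, rfl⟩ | ⟨-, rfl⟩ <;> norm_num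
  have hζ : zeta F r = ε * |zeta F r| := by rw [← hε, ← mul_assoc, hε1, one_mul]
  have hf3 : Fintype.card V - 3 = f := by omega
  have hf2 : Fintype.card V - 2 = f + 1 := by omega
  have hcast4 : (Fintype.card V : ℤ) - 4 = (f : ℤ) - 1 := by omega
  have hcast3 : (Fintype.card V : ℤ) - 3 = (f : ℤ) := by omega
  -- the expansions of `c`
  have hexp1 := fun j : Fin r => powBound_cPoly_sub F r hV
    (fun n i => (partSize (residue n r) (Equiv.swap 0 j i) : ℝ) - n / r) 1
    (fun n i => abs_partSize_residue_sub_le n r _)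
    (fun n => sum_partSize_residue_sub n r (Equiv.swap 0 j))
  have hexp2 := powBound_cPoly_sub F r hV
    (fun n i => (partSize (residue n r) (Equiv.swap 0 s i) : ℝ) +
      (if Equiv.swap 0 s i = a then 1 else 0) - (if Equiv.swap 0 s i = b then 1 else 0) - n / r) 3
    (fun n i => by
      have h1 := abs_le.1 (abs_partSize_residue_sub_le n r (Equiv.swap 0 s i))
      rw [abs_le]
      split_ifs <;> constructor <;> linarith)
    (fun n => by
      have h1 := sum_partSize_residue_sub n r (Equiv.swap 0 s)
      have h2 : ∀ c : Fin r, ∑ i, (if Equiv.swap 0 s i = c then (1 : ℝ) else 0) = 1 := by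
        intro c
        rw [Equiv.sum_comp (Equiv.swap 0 s) fun i => if i = c then (1 : ℝ) else 0]
        simp
      have h3 : ∑ i, ((if Equiv.swap 0 s i = a then (1 : ℝ) else 0) -
          if Equiv.swap 0 s i = b then (1 : ℝ) else 0) = 0 := by
        rw [sum_sub_distrib, h2 a, h2 b, sub_self]
      have h4 := congrArg₂ (· + ·) h1 h3
      beta_reduce at h4
      rw [← sum_add_distrib, add_zero] at h4
      refine (sum_congr rfl fun i _ => ?_).trans h4
      ring)
  have hexp3 := powBound_cPoly_balanced F r hV
  simp only [hf3, hf2, hcast4, hcast3, add_sub_cancel] at hexp1 hexp2 hexp3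
  have hexp1' := fun j => (hexp1 j).exists_bound_div
  choose C₁' hC₁' hb1 using hexp1'
  obtain ⟨C₂, hC₂, hb2⟩ := hexp2.exists_bound_div
  obtain ⟨C₃, hC₃, hb3⟩ := hexp3.exists_bound
  let C₁ := ∑ j, C₁' j
  have hC₁ : 0 ≤ C₁ := sum_nonneg fun j _ => hC₁' j
  have hC₁j : ∀ j, C₁' j ≤ C₁ := fun j => single_le_sum (fun j _ => hC₁' j) (mem_univ j)
  obtain ⟨D, hD⟩ := exists_nat_ge ((β + 2) * (2 * (r : ℝ)))
  have hD0 : 0 < D := by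
    have : (0 : ℝ) < D := lt_of_lt_of_le (by positivity) hD
    exact_mod_cast this
  let C₄ : ℝ := (Fintype.card V ^ 6 * (2 * D) ^ 3 : ℕ)
  have hgap : 0 < β * |zeta F r| - L * alpha F r := by linarith
  have hlarge : ∀ᶠ n : ℕ in atTop, (β + 1) * (C₁ + C₂) + L * (C₂ + C₃) + C₄ <
      (β * |zeta F r| - L * alpha F r) * n :=
    (tendsto_natCast_atTop_atTop.const_mul_atTop hgap).eventually_gt_atTop _
  filter_upwards [eventually_mul_le_tFun hF.1, eventually_all.2 hb1, hb2, hb3, hlarge,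
    eventually_ge_atTop 1, eventually_ge_atTop (2 * r), eventually_div_sub_ge r hD0 hD (L := L),
    (eventually_iso_turanGraph Nat.AtLeastTwo.prop (not_colorable_of_isCritical hF.1)
      (exists_colorable_deleteEdges hF.1).choose_spec)] with
    n ht hn1 hn2 hn3 hn4 hn5 hn6 hn7 hn8 hL
  by_contra! hlt
  have hn : (1 : ℝ) ≤ n := by exact_mod_cast hn5
  -- If `q_F(n) > βn`, then `h_F = t_F` at this `q`, and both bounds apply to one number.
  obtain ⟨q, hqdef⟩ : ∃ q, q = ⌈β * n⌉₊ := ⟨_, rfl⟩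
  have hq1 : β * n ≤ q := hqdef ▸ Nat.le_ceil _
  have hq2 : (q : ℝ) < β * n + 1 := hqdef ▸ Nat.ceil_lt_add_one (by positivity)
  have hqpos : 0 < q := hqdef ▸ Nat.ceil_pos.2 (by positivity)
  have hqle : q ≤ qFun F n := hqdef ▸ Nat.ceil_le.2 hlt.le
  obtain ⟨hq3, hq4⟩ := qFun_spec hqpos hqle
  -- the competing graph
  have hbpos : 0 < partSize (residue n r) b := by
    rw [partSize_residue]
    have : 1 ≤ n / r := (Nat.le_div_iff_mul_le (NeZero.pos r)).2 (by omega)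
    omega
  obtain ⟨p', hp'⟩ := exists_move_vertex (residue n r) (a := a) hbpos
  -- Part `s` is renamed 0, where block graphs live.
  obtain ⟨p, hpdef⟩ : ∃ p : Fin n → Fin r, p = fun w => Equiv.swap 0 s (p' w) := ⟨_, rfl⟩
  have hp : ∀ i, (partSize p i : ℝ) = (partSize (residue n r) (Equiv.swap 0 s i) : ℝ) +
      (if Equiv.swap 0 s i = a then 1 else 0) - (if Equiv.swap 0 s i = b then 1 else 0) := by
    intro i
    rw [hpdef, partSize_perm_comp, hp']
  have hp0 : (partSize p 0 : ℝ) = partSize (residue n r) s + ε := by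
    rw [hp, Equiv.swap_apply_left]
    rcases hs with ⟨rfl, rfl⟩ | ⟨rfl, rfl⟩
    · simp [hab]
    · simp [hab.symm]; ring
  have hds := abs_le.1 (abs_partSize_residue_sub_le n r s)
  have hq5 : q + L ≤ partSize p 0 / (2 * D) * (D * D) := by
    have h1 := hn7 (partSize p 0) (by
      rw [hp0]
      have := abs_le.1 hεabs.le
      linarith)
    have h2 : ((q + L : ℕ) : ℝ) ≤ (partSize p 0 / (2 * D) * (D * D) : ℕ) := by
      push_cast at h1 ⊢
      linarith
    exact_mod_cast h2
  obtain ⟨B, blk, lab, hB, hBcard⟩ := exists_isBlockGraph p hD0 (Nat.mul_div_le _ _) hq5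
  have hmove := card_edges_move (residue n r) p hab (Equiv.swap 0 s) hp
  have hL' : (partSize (residue n r) a : ℝ) + 1 = partSize (residue n r) b + L := by
    exact_mod_cast hL
  have hedges : #(multipartite p).edgeFinset + #B.edgeFinset = extremalNumber n F + q := by
    rw [hn8.1]
    have h1 : #(turanGraph n r).edgeFinset = #(multipartite (residue n r)).edgeFinset := by
      convert card_edges_turanGraph n r
    have h2 : (#(multipartite (residue n r)).edgeFinset : ℝ) = #(multipartite p).edgeFinset + L := by
      linarith
    have h3 : #(multipartite (residue n r)).edgeFinset = #(multipartite p).edgeFinset + L := by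
      exact_mod_cast h2
    rw [h1, h3, hBcard]
    omega
  have hup := hFun_le hF hB hedges
  -- comparison
  have hY : (0 : ℝ) < (n : ℝ) ^ f := by positivity
  have hlow := ht q (MvPolynomial.eval (fun _ => (n : ℝ) / r) (cPoly F r) -
    (partSize (residue n r) s - n / r) * (zeta F r * (n : ℝ) ^ f) - C₁ * ((n : ℝ) ^ f / n)) hq3 (by
      intro j
      have h1 := (abs_le.1 (hn1 j)).1
      rw [Equiv.swap_apply_left] at h1
      have h2 : C₁' j * ((n : ℝ) ^ f / n) ≤ C₁ * ((n : ℝ) ^ f / n) :=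
        mul_le_mul_of_nonneg_right (hC₁j j) (by positivity)
      -- Being of extreme size in the direction of `ζ_F`, part `s` is where an added edge is
      -- cheapest up to lower order.
      have h3 : ((partSize (residue n r) j : ℝ) - n / r) * (zeta F r * (n : ℝ) ^ f) ≤
          (partSize (residue n r) s - n / r) * (zeta F r * (n : ℝ) ^ f) := by
        have h4 : (ε * partSize (residue n r) j) * (|zeta F r| * (n : ℝ) ^ f) ≤
          (ε * partSize (residue n r) s) * (|zeta F r| * (n : ℝ) ^ f) :=
          mul_le_mul_of_nonneg_right (hext n j) (by positivity)
        rw [hζ]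
        linarith
      linarith)
  rw [← hq4] at hlow
  have hcount := hlow.trans hup
  rw [hBcard, hf3] at hcount
  push_cast at hcount
  refine absurd (le_of_count_bounds (d := partSize (residue n r) s - n / r) (C₃ := C₃)
    (C₂ := C₂) (C₁ := C₁) (α := alpha F r) (C₄ := C₄) (L := L)
    (x := MvPolynomial.eval (fun i => (partSize p i : ℝ)) (cPoly F r)) hn hY hq1 (by linarith)
    (by positivity) (by positivity) hC₂ hC₁ hε (abs_nonneg _) ?_ rfl ?_ ?_
    (hcount.trans_eq ?_)) (not_le.2 hn4)
  · rw [← neg_mul]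
    refine (le_abs_self _).trans ?_
    rw [abs_mul, abs_neg]
    exact mul_le_of_le_one_left (abs_nonneg _) (abs_le.2 hds)
  · have h1 := (abs_le.1 hn2).2
    simp only [← hp, hp0] at h1
    linarith
  · have h1 := (abs_le.1 hn3).2
    rw [pow_succ] at h1
    linarith
  · simp only [C₄]
    push_cast
    ring

/-- For positive `ζ_F` a vertex moves from part 1 to part 0, whose sizes differ only if `n % r = 1`.
For negative `ζ_F` it moves from part `r - 1` to part `r - 2`, whose sizes differ only if `n % r = r
- 1`. -/
lemma eventually_qFun_le_of_residue {V : Type*} [Fintype V] {F : SimpleGraph V} {r : ℕ}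
    [r.AtLeastTwo] (hF : IsPairFree F r) (hζ : zeta F r ≠ 0) {L : ℕ} {β : ℝ} (hβ0 : 0 < β)
    (hβ : L * alpha F r < β * |zeta F r|) :
    ∀ᶠ n : ℕ in atTop, L = (if (n : ZMod r) = ((SignType.sign (zeta F r) : ℤ) : ZMod r)
      then 2 else 1) → (qFun F n : ℝ) ≤ β * n := by
  have hr : 2 ≤ r := Nat.AtLeastTwo.prop
  rcases hζ.lt_or_gt with h | h
  · have hlt1 : r - 2 < r := by omega
    have hlt2 : r - 1 < r := by omega
    filter_upwards [eventually_qFun_le hF (a := ⟨r - 2, hlt1⟩) (b := ⟨r - 1, hlt2⟩)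
      (s := ⟨r - 1, hlt2⟩) (ε := -1) (by rw [Ne, Fin.mk.injEq]; omega) (Or.inr ⟨rfl, rfl⟩)
      (by rw [abs_of_neg h]; ring) (fun n j => by
        have : partSize (residue n r) ⟨r - 1, hlt2⟩ ≤ partSize (residue n r) j := by
          have := Nat.mod_lt n (by omega : 0 < r)
          rw [partSize_residue, partSize_residue, if_neg (by dsimp only; omega)]
          omega
        have : (partSize (residue n r) ⟨r - 1, hlt2⟩ : ℝ) ≤ partSize (residue n r) j := by
          exact_mod_cast this
        linarith) hβ0 hβ] with n hn hL
    refine hn ?_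
    have hiff : (n : ZMod r) = ((SignType.sign (zeta F r) : ℤ) : ZMod r) ↔ n % r = r - 1 := by
      have h1 : ((SignType.sign (zeta F r) : ℤ) : ZMod r) = ((r - 1 : ℕ) : ZMod r) := by
        rw [sign_neg h, Nat.cast_sub (by omega)]
        simp
      rw [h1, ZMod.natCast_eq_natCast_iff', Nat.mod_eq_of_lt hlt2]
    have := Nat.mod_lt n (by omega : 0 < r)
    rw [partSize_residue, partSize_residue, hL]
    simp only [hiff]
    split_ifs <;> omega
  · have hlt1 : 0 < r := by omega
    have hlt2 : 1 < r := by omega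
    filter_upwards [eventually_qFun_le hF (a := ⟨0, hlt1⟩) (b := ⟨1, hlt2⟩)
      (s := ⟨0, hlt1⟩) (ε := 1) (by rw [Ne, Fin.mk.injEq]; omega) (Or.inl ⟨rfl, rfl⟩)
      (by rw [abs_of_pos h]; ring) (fun n j => by
        have : partSize (residue n r) j ≤ partSize (residue n r) ⟨0, hlt1⟩ := by
          rw [partSize_residue, partSize_residue]
          dsimp only
          split_ifs <;> omega
        have : (partSize (residue n r) j : ℝ) ≤ partSize (residue n r) ⟨0, hlt1⟩ := by
          exact_mod_cast this
        linarith) hβ0 hβ] with n hn hL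
    refine hn ?_
    have hiff : (n : ZMod r) = ((SignType.sign (zeta F r) : ℤ) : ZMod r) ↔ n % r = 1 := by
      have h1 : ((SignType.sign (zeta F r) : ℤ) : ZMod r) = ((1 : ℕ) : ZMod r) := by
        rw [sign_pos h]
        simp
      rw [h1, ZMod.natCast_eq_natCast_iff', Nat.mod_eq_of_lt hlt2]
    rw [partSize_residue, partSize_residue, hL]
    simp only [hiff]
    split_ifs <;> omega

/-- Turns eventual bounds into frequent ones; along a trivial filter the limit inferior would be
infinite. -/
lemma neBot_residueClass (r : ℕ) [NeZero r] (i : ZMod r) :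
    (atTop ⊓ 𝓟 {n : ℕ | (n : ZMod r) = i}).NeBot := by
  rw [← frequently_mem_iff_neBot, frequently_atTop]
  intro N
  refine ⟨i.val + r * N, ?_, ?_⟩
  · nlinarith [NeZero.pos r, Nat.zero_le i.val]
  · simp

/-- Every real `β` above `L * α_F / |ζ_F|` bounds the limit inferior, and `β` may be taken
arbitrarily close. -/
lemma c1_le_of_eventually {V : Type*} [Fintype V] {F : SimpleGraph V} {r : ℕ} [r.AtLeastTwo]
    (hζ : zeta F r ≠ 0) {L : ℕ} {i : ZMod r}
    (h : ∀ β : ℝ, 0 < β → L * alpha F r < β * |zeta F r| →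
      ∀ᶠ n : ℕ in atTop, (n : ZMod r) = i → (qFun F n : ℝ) ≤ β * n) :
    c1 F r i ≤ L * piParam F r := by
  have hz : 0 < |zeta F r| := abs_pos.2 hζ
  refine le_of_forall_gt_imp_ge_of_dense fun x hx => ?_
  rcases eq_or_ne x ⊤ with rfl | hxtop
  · exact le_top
  obtain ⟨β, hβ0, rfl⟩ : ∃ β : ℝ, 0 < β ∧ x = ENNReal.ofReal β :=
    ⟨x.toReal, ENNReal.toReal_pos (pos_of_gt hx).ne' hxtop, (ENNReal.ofReal_toReal hxtop).symm⟩
  rw [piParam, if_neg hζ, ← ENNReal.ofReal_natCast, ← ENNReal.ofReal_mul (by positivity),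
    ENNReal.ofReal_lt_ofReal_iff hβ0, mul_div_assoc', div_lt_iff₀ hz] at hx
  have := neBot_residueClass r i
  refine liminf_le_of_frequently_le' (Eventually.frequently ?_)
  rw [eventually_inf_principal]
  filter_upwards [h β hβ0 hx, eventually_ge_atTop 1] with n hn h1 hni
  have hn0 : (0 : ℝ) < n := by exact_mod_cast h1
  rw [← ENNReal.ofReal_natCast, ← ENNReal.ofReal_natCast, ← ENNReal.ofReal_div_of_pos hn0]
  exact ENNReal.ofReal_le_ofReal ((div_le_iff₀ hn0).2 (hn hni))

end ColorCritical

theorem mainTheorem8 {V : Type*} [Fintype V] (F : SimpleGraph V) (r : ℕ) [r.AtLeastTwo]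
    (hF : ColorCritical.IsPairFree F r) (t : ZMod r)
    (ht : t = ((SignType.sign (ColorCritical.zeta F r) : ℤ) : ZMod r)) :
    ColorCritical.c1 F r t ≤ 2 * ColorCritical.piParam F r ∧
      ∀ i : ZMod r, i ≠ t → ColorCritical.c1 F r i ≤ ColorCritical.piParam F r := by
  by_cases hζ : ColorCritical.zeta F r = 0
  · simp [ColorCritical.piParam, hζ]
  refine ⟨?_, fun i hi => ?_⟩
  · refine (ColorCritical.c1_le_of_eventually hζ (L := 2) fun β hβ0 hβ => ?_).trans_eq (by norm_num)
    filter_upwards [ColorCritical.eventually_qFun_le_of_residue hF hζ hβ0 hβ] with n hn hni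
    exact hn (by rw [if_pos (hni.trans ht)])
  · refine (ColorCritical.c1_le_of_eventually hζ (L := 1) fun β hβ0 hβ => ?_).trans_eq (by simp)
    filter_upwards [ColorCritical.eventually_qFun_le_of_residue hF hζ hβ0 hβ] with n hn hni
    exact hn (by rw [if_neg (by rw [hni, ← ht]; exact hi)])
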